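/- Let $M$ be a globally hyperbolic spacetime of dimension $m\ge 1$, i.e. a connected, Hausdorff, second-countable smooth $m$-manifold with a smooth Lorentzian metric of signature $(-,+,\dots,+)$, an orientation and a time-orientation, and admitting a Cauchy surface. Suppose that $i_\Sigma:\Sigma\to M$ is a compact, smooth, spacelike Cauchy surface, with the induced orientation and fundamental class $[\Sigma]\in H_{m-1}(\Sigma;\mathbb Z)$. Write $\mathbb T=\mathbb R/\mathbb Z$ and let $0\le k\le m$. Put $\mathrm{Top}^k_{\mathrm{tor}}(M)=H^k_{\mathrm{tor}}(M;\mathbb Z)\times H^{m-k}_{\mathrm{tor}}(M;\mathbb Z)$, where $H^p_{\mathrm{tor}}$ is the torsion subgroup of singular cohomology. For $t\in H^p_{\mathrm{tor}}(\Sigma;\mathbb Z)$ and $t'\in H^{m-p}_{\mathrm{tor}}(\Sigma;\mathbb Z)$ put $\langle t,t'\rangle=(u\smile t')[\Sigma]\in\mathbb T$, where $u\in H^{p-1}(\Sigma;\mathbb T)$ is any class whose Bockstein is $t$ (the pairing is $0$ for $p=0$), and equip $\mathrm{Top}^k_{\mathrm{tor}}(M)$ with the antisymmetric bi-homomorphism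 $$\sigma_{\mathrm{tor}}\big((t,\tilde t),(t',\tilde t')\big)=\langle i_\Sigma^*\tilde t,i_\Sigma^*t'\rangle-\langle i_\Sigma^*\tilde t',i_\Sigma^*t\rangle .$$ For an abelian group $G$ with an antisymmetric bi-homomorphism $\sigma:G\times G\to\mathbb T$, let $\mathcal A(G)$ be the unital $*$-algebra with linear basis $W(x)$, $x\in G$, and relations $W(x)^*=W(-x)$, $W(x)W(y)=e^{2\pi i\sigma(x,y)}W(x+y)$; let $\mathcal B(G)$ be the Banach $*$-algebra obtained by completing $\mathcal A(G)$ in the norm $\|\sum_j\alpha_jW(x_j)\|_1=\sum_j|\alpha_j|$ ($x_j$ distinct); and let $\mathcal W(G)$ be the enveloping $C^*$-algebra of $\mathcal B(G)$. Then: 1. There is a unique bounded linear functional $\omega_{\mathrm{tor}}:\mathcal W(\mathrm{Top}^k_{\mathrm{tor}}(M))\to\mathbb C$ with $\omega_{\mathrm{tor}}(W(t,\tilde t))=1$ if $t=0$ and $\tilde t=0$, and $\omega_{\mathrm{tor}}(W(t,\tilde t))=0$ otherwise. It is a state, and it is faithful: $\omega_{\mathrm{tor}}(a^*a)=0$ implies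 $a=0$, for all $a\in\mathcal W(\mathrm{Top}^k_{\mathrm{tor}}(M))$. 2. Let $\zeta_{\mathrm{tor}}:\mathrm{Top}^k_{\mathrm{tor}}(M)\to\mathrm{Top}^{m-k}_{\mathrm{tor}}(M)$, $(t,\tilde t)\mapsto(\tilde t,(-1)^{k(m-k)+1}t)$. There is a unique unital $*$-homomorphism $\mathcal W(\zeta_{\mathrm{tor}}):\mathcal W(\mathrm{Top}^k_{\mathrm{tor}}(M))\to\mathcal W(\mathrm{Top}^{m-k}_{\mathrm{tor}}(M))$ with $W(t,\tilde t)\mapsto W(\zeta_{\mathrm{tor}}(t,\tilde t))$, and the functionals of part 1 for $m-k$ and for $k$ satisfy $$\omega_{\mathrm{tor}}\circ\mathcal W(\zeta_{\mathrm{tor}})=\omega_{\mathrm{tor}} .$$ -/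

import Mathlib

open scoped ComplexOrder

noncomputable section

namespace AbelianDuality

universe u v

/-! ## Singular (co)homology -/

/-- Singular `n`-simplices of a topological space. -/
abbrev SingularSimplex (X : Type u) [TopologicalSpace X] (n : ℕ) : Type u :=
  C(stdSimplex ℝ (Fin (n + 1)), X)

theorem val_succAbove {n : ℕ} (i : Fin (n + 1)) (k : Fin n) :
    (i.succAbove k : ℕ) = if (k : ℕ) < i then (k : ℕ) else k + 1 := by
  simp only [Fin.succAbove, Fin.lt_def, Fin.val_castSucc]
  split_ifs <;> simp

namespace SingularSimplex

variable {X : Type u} [TopologicalSpace X]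

/-- Precomposition with the affine map of standard simplices given by a map of vertices. -/
def reindex {m n : ℕ} (f : Fin (m + 1) → Fin (n + 1)) (s : SingularSimplex X n) :
    SingularSimplex X m :=
  s.comp ⟨stdSimplex.map f, stdSimplex.continuous_map f⟩

theorem reindex_reindex {l m n : ℕ} (f : Fin (l + 1) → Fin (m + 1))
    (g : Fin (m + 1) → Fin (n + 1)) (s : SingularSimplex X n) :
    reindex f (reindex g s) = reindex (g ∘ f) s := by
  ext x
  simp [reindex, stdSimplex.map_comp_apply]

/-- The `i`-th face. -/
def face {n : ℕ} (i : Fin (n + 2)) (s : SingularSimplex X (n + 1)) : SingularSimplex X n :=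
  reindex i.succAbove s

theorem face_face {n : ℕ} (s : SingularSimplex X (n + 2)) (i : Fin (n + 2)) (j : Fin (n + 3))
    (h : (j : ℕ) ≤ i) :
    face i (face j s) =
      face (j.castLT (by omega)) (face i.succ s) := by
  simp only [face, reindex_reindex]
  congr 1
  funext k
  ext
  simp [Function.comp, val_succAbove]
  all_goals (try split_ifs) <;> omega

/-- The front `p`-face `[v₀, …, v_p]` of an `n`-simplex. -/
def front {p n : ℕ} (h : p ≤ n) (s : SingularSimplex X n) : SingularSimplex X p :=
  reindex (fun i => ⟨i, by omega⟩) s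

/-- The face `[v_p, …, v_n]` of an `n`-simplex, where `p + q = n`. -/
def back {p q n : ℕ} (h : p + q = n) (s : SingularSimplex X n) : SingularSimplex X q :=
  reindex (fun i => ⟨p + i, by omega⟩) s

end SingularSimplex

open SingularSimplex

section Cohomology

variable (X : Type u) [TopologicalSpace X] (A : Type v) [AddCommGroup A]

/-- Singular `n`-cochains with coefficients in `A`. -/
abbrev Cochain (n : ℕ) : Type (max u v) := SingularSimplex X n → A

variable {X A}

/-- The coboundary operator `(d f)(s) = ∑ᵢ (-1)ⁱ f(∂ᵢ s)`. -/
def coboundary (n : ℕ) : Cochain X A n →+ Cochain X A (n + 1) where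
  toFun f s := ∑ i : Fin (n + 2), (-1 : ℤ) ^ (i : ℕ) • f (face i s)
  map_zero' := by funext s; simp
  map_add' f g := by funext s; simp [Finset.sum_add_distrib]

theorem coboundary_apply (n : ℕ) (f : Cochain X A n) (s : SingularSimplex X (n + 1)) :
    coboundary n f s = ∑ i : Fin (n + 2), (-1 : ℤ) ^ (i : ℕ) • f (face i s) := rfl

theorem coboundary_coboundary (n : ℕ) (f : Cochain X A n) :
    coboundary (n + 1) (coboundary n f) = 0 := by
  funext s
  simp only [coboundary_apply, Pi.zero_apply, Finset.smul_sum]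
  rw [← Finset.sum_product', Finset.univ_product_univ]
  let P := Fin (n + 3) × Fin (n + 2)
  let S : Finset P := {ij : P | (ij.1 : ℕ) ≤ (ij.2 : ℕ)}
  rw [← Finset.sum_add_sum_compl S, ← eq_neg_iff_add_eq_zero, ← Finset.sum_neg_distrib]
  let φ : ∀ ij : P, ij ∈ S → P := fun ij hij =>
    (ij.2.succ, Fin.castLT ij.1 (lt_of_le_of_lt (Finset.mem_filter.mp hij).right (Fin.is_lt ij.2)))
  apply Finset.sum_bij φ
  · intro ij hij
    simp_rw [S, φ, Finset.compl_filter, Finset.mem_filter_univ, Fin.val_succ,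
      Fin.val_castLT] at hij ⊢
    omega
  · rintro ⟨i, j⟩ hij ⟨i', j'⟩ hij' h
    rw [Prod.mk_inj]
    exact ⟨by simpa [φ, Fin.castSucc_castLT] using! congr_arg Fin.castSucc (congr_arg Prod.snd h),
      by simpa [φ] using! congr_arg Prod.fst h⟩
  · rintro ⟨i', j'⟩ hij'
    simp_rw [S, Finset.compl_filter, Finset.mem_filter_univ, not_le] at hij'
    refine ⟨(Fin.castSucc j', i'.pred <| ?_), ?_, ?_⟩
    · rintro rfl
      simp only [Fin.val_zero, not_lt_zero] at hij'
    · simpa [S] using! Nat.le_sub_one_of_lt hij'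
    · simp only [φ, Fin.castLT_castSucc, Fin.succ_pred]
  · rintro ⟨i, j⟩ hij
    have h : (i : ℕ) ≤ j := by simpa [S] using hij
    simp only [φ, smul_smul, ← neg_smul]
    rw [face_face s j i h]
    congr 1
    simp only [Fin.val_succ, Fin.val_castLT, pow_succ]
    ring

/-- Cup product of cochains, `(a ⌣ b)(s) = b[v_p, …, v_n] • a[v₀, …, v_p]`, for
`a` with values in an abelian group and `b` with integer values. -/
def cochainCup {p q n : ℕ} (h : p + q = n) : Cochain X A p →+ Cochain X ℤ q →+ Cochain X A n :=
  AddMonoidHom.mk'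
    (fun a => AddMonoidHom.mk' (fun b s => b (back h s) • a (front (by omega) s))
      (fun b b' => by funext s; simp [add_smul]))
    (fun a a' => by ext b s; simp)

theorem cochainCup_apply {p q n : ℕ} (h : p + q = n) (a : Cochain X A p) (b : Cochain X ℤ q)
    (s : SingularSimplex X n) :
    cochainCup h a b s = b (back h s) • a (front (by omega) s) := rfl

theorem coboundary_cochainCup {p q n : ℕ} (h : p + q = n) (a : Cochain X A p)
    (b : Cochain X ℤ q) :
    coboundary n (cochainCup h a b) =
      cochainCup (by omega) (coboundary p a) b +
        (-1 : ℤ) ^ p • cochainCup (by omega) a (coboundary q b) := by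
  subst h
  funext s
  simp only [coboundary_apply, cochainCup_apply, Pi.add_apply, Pi.smul_apply]
  have e : (p + 1) + (q + 1) = p + q + 2 := by omega
  rw [← (finCongr e).sum_comp, Fin.sum_univ_add]
  rw [Fin.sum_univ_castSucc (n := p + 1), Fin.sum_univ_succ (n := q + 1)]
  have h1 : ∀ i : Fin (p + 1),
      b (back rfl (face (finCongr e (Fin.castAdd (q + 1) i)) s)) •
        a (front (Nat.le_add_right p q) (face (finCongr e (Fin.castAdd (q + 1) i)) s)) =
      b (back (by omega : (p + 1) + q = p + q + 1) s) •
        a (face i.castSucc (front (by omega : p + 1 ≤ p + q + 1) s)) := by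
    intro i
    congr 2
    · simp only [face, back, reindex_reindex]
      congr 1
      funext k
      ext
      simp [Function.comp, val_succAbove]
      split_ifs <;> omega
    · simp only [face, front, reindex_reindex]
      congr 1
      funext k
      ext
      simp [Function.comp, val_succAbove]
      
  have h2 : ∀ i : Fin (q + 1),
      b (back rfl (face (finCongr e (Fin.natAdd (p + 1) i)) s)) •
        a (front (Nat.le_add_right p q) (face (finCongr e (Fin.natAdd (p + 1) i)) s)) =
      b (face i.succ (back (by omega : p + (q + 1) = p + q + 1) s)) •
        a (front (by omega : p ≤ p + q + 1) s) := by
    intro i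
    congr 2
    · simp only [face, back, reindex_reindex]
      congr 1
      funext k
      ext
      simp [Function.comp, val_succAbove]
      all_goals (try split_ifs) <;> omega
    · simp only [face, front, reindex_reindex]
      congr 1
      funext k
      ext
      simp [Function.comp, val_succAbove]
      omega
  have h3 : face (Fin.last (p + 1)) (front (by omega : p + 1 ≤ p + q + 1) s) =
      front (by omega : p ≤ p + q + 1) s := by
    simp only [face, front, reindex_reindex]
    congr 1
    funext k
    ext
    simp [Function.comp]
  have h4 : face 0 (back (by omega : p + (q + 1) = p + q + 1) s) =
      back (by omega : (p + 1) + q = p + q + 1) s := by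
    simp only [face, back, reindex_reindex]
    congr 1
    funext k
    ext
    simp [Function.comp]
    omega
  simp only [h1, h2, h3, h4]
  simp only [smul_add, Finset.smul_sum, add_smul, Finset.sum_smul, smul_smul, finCongr_apply,
    Fin.val_cast, Fin.val_castAdd, Fin.val_natAdd, Fin.val_castSucc, Fin.val_last, Fin.val_succ,
    Fin.val_zero, smul_eq_mul]
  have key : ∀ S1 S2 S2' x y z: A, S2 = S2' → y + z = 0 → S1 + S2 = S1 + y + (z + S2') := by
    intro S1 S2 S2' x y z hS hyz
    rw [hS, add_assoc, ← add_assoc y, hyz, zero_add]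
  have hc : ∀ i : Fin (p + 1), (-1 : ℤ) ^ (i : ℕ) * b (back (by omega : (p + 1) + q = p + q + 1) s)
      = b (back (by omega : (p + 1) + q = p + q + 1) s) * (-1 : ℤ) ^ (i : ℕ) :=
    fun i => mul_comm _ _
  simp only [hc]
  refine key _ _ _ 0 _ _ ?_ ?_
  · refine Finset.sum_congr rfl fun i _ => ?_
    congr 1
    ring
  · rw [← add_smul]
    convert zero_smul ℤ _
    ring

variable (X A)

/-- Singular cocycles. -/
def cocycles (n : ℕ) : AddSubgroup (Cochain X A n) := (coboundary n).ker

/-- Singular coboundaries. -/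
def coboundaries : (n : ℕ) → AddSubgroup (Cochain X A n)
  | 0 => ⊥
  | n + 1 => (coboundary n).range

/-- Singular cohomology `Hⁿ(X; A)`. -/
abbrev Cohomology (n : ℕ) : Type (max u v) :=
  cocycles X A n ⧸ (coboundaries X A n).addSubgroupOf (cocycles X A n)

/-- The torsion subgroup of `Hⁿ(X; ℤ)`. -/
abbrev TorsionCohomology (n : ℕ) : AddSubgroup (Cohomology X ℤ n) :=
  AddCommGroup.torsion (Cohomology X ℤ n)

variable {X A}

theorem mem_cocycles {n : ℕ} {f : Cochain X A n} : f ∈ cocycles X A n ↔ coboundary n f = 0 :=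
  Iff.rfl

/-- The cohomology class of a cocycle. -/
def cohomologyClass {n : ℕ} : cocycles X A n →+ Cohomology X A n :=
  QuotientAddGroup.mk' _

theorem cohomologyClass_eq_zero {n : ℕ} {f : cocycles X A n} :
    cohomologyClass f = 0 ↔ (f : Cochain X A n) ∈ coboundaries X A n := by
  simp [cohomologyClass, AddSubgroup.mem_addSubgroupOf]

theorem cohomologyClass_surjective {n : ℕ} :
    Function.Surjective (cohomologyClass : cocycles X A n → Cohomology X A n) :=
  QuotientAddGroup.mk'_surjective _

/-- A homomorphism out of cohomology from one on cocycles that kills coboundaries. -/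
def Cohomology.lift {n : ℕ} {B : Type*} [AddCommGroup B] (φ : cocycles X A n →+ B)
    (h : ∀ f : cocycles X A n, (f : Cochain X A n) ∈ coboundaries X A n → φ f = 0) :
    Cohomology X A n →+ B :=
  QuotientAddGroup.lift _ φ fun f hf => h f (AddSubgroup.mem_addSubgroupOf.mp hf)

@[simp] theorem Cohomology.lift_class {n : ℕ} {B : Type*} [AddCommGroup B]
    (φ : cocycles X A n →+ B)
    (h : ∀ f : cocycles X A n, (f : Cochain X A n) ∈ coboundaries X A n → φ f = 0)
    (f : cocycles X A n) : Cohomology.lift φ h (cohomologyClass f) = φ f := rfl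

theorem cohomologyClass_eq_add {n : ℕ} {f g g' : cocycles X A n}
    (h : (f : Cochain X A n) = g + g') :
    cohomologyClass f = cohomologyClass g + cohomologyClass g' := by
  rw [← AddMonoidHom.map_add cohomologyClass g g']
  exact congrArg _ (Subtype.ext h)

/-- Pullback of cochains. -/
def Cochain.pullback {Y : Type*} [TopologicalSpace Y] (i : C(X, Y)) (n : ℕ) :
    Cochain Y A n →+ Cochain X A n where
  toFun f s := f (i.comp s)
  map_zero' := rfl
  map_add' _ _ := rfl

theorem Cochain.coboundary_pullback {Y : Type*} [TopologicalSpace Y] (i : C(X, Y)) (n : ℕ)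
    (f : Cochain Y A n) :
    coboundary n (Cochain.pullback i n f) = Cochain.pullback i (n + 1) (coboundary n f) := rfl

/-- Pullback in cohomology along a continuous map. -/
def Cohomology.pullback {Y : Type*} [TopologicalSpace Y] (i : C(X, Y)) (n : ℕ) :
    Cohomology Y A n →+ Cohomology X A n :=
  Cohomology.lift
    (cohomologyClass.comp
      (((Cochain.pullback i n).comp (cocycles Y A n).subtype).codRestrict (cocycles X A n)
        (fun f => by
          rw [mem_cocycles]
          simp [Cochain.coboundary_pullback, mem_cocycles.mp f.2])))
    (by
      rintro ⟨f, hf⟩ hb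
      simp only [AddMonoidHom.coe_comp, Function.comp_apply]
      rw [cohomologyClass_eq_zero]
      cases n with
      | zero =>
        obtain rfl : f = 0 := hb
        exact zero_mem _
      | succ n =>
        obtain ⟨e, he⟩ := hb
        exact ⟨Cochain.pullback i n e, by
          rw [Cochain.coboundary_pullback, he]; rfl⟩)

/-- Pullback of torsion classes. -/
def TorsionCohomology.pullback {Y : Type*} [TopologicalSpace Y] (i : C(X, Y)) (n : ℕ) :
    TorsionCohomology Y n →+ TorsionCohomology X n :=
  ((Cohomology.pullback i n).comp (TorsionCohomology Y n).subtype).codRestrict _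
    (fun t => (Cohomology.pullback i n).isOfFinAddOrder t.2)

theorem cochainCup_mem_cocycles {p q n : ℕ} (h : p + q = n) (a : cocycles X A p)
    (b : cocycles X ℤ q) : cochainCup h (a : Cochain X A p) (b : Cochain X ℤ q) ∈
      cocycles X A n := by
  rw [mem_cocycles, coboundary_cochainCup, mem_cocycles.mp a.2, mem_cocycles.mp b.2]
  simp

/-- The cup product of two cocycles as a cohomology class. -/
def cocycleCup {p q n : ℕ} (h : p + q = n) :
    cocycles X A p →+ cocycles X ℤ q →+ Cohomology X A n :=
  AddMonoidHom.mk'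
    (fun a => AddMonoidHom.mk'
      (fun b => cohomologyClass ⟨cochainCup h (a : Cochain X A p) (b : Cochain X ℤ q),
        cochainCup_mem_cocycles h a b⟩)
      (fun b b' => cohomologyClass_eq_add (by simp)))
    (fun a a' => by
      ext b
      exact cohomologyClass_eq_add (by simp))

theorem cocycleCup_apply {p q n : ℕ} (h : p + q = n) (a : cocycles X A p) (b : cocycles X ℤ q) :
    cocycleCup h a b =
      cohomologyClass ⟨cochainCup h (a : Cochain X A p) (b : Cochain X ℤ q),
        cochainCup_mem_cocycles h a b⟩ := by
  simp only [cocycleCup, AddMonoidHom.mk'_apply]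

theorem cocycleCup_eq_zero_left {p q n : ℕ} (h : p + q = n) (a : cocycles X A p)
    (b : cocycles X ℤ q) (ha : (a : Cochain X A p) ∈ coboundaries X A p) :
    cocycleCup h a b = 0 := by
  rw [cocycleCup_apply, cohomologyClass_eq_zero]
  cases p with
  | zero =>
    obtain ha : (a : Cochain X A 0) = 0 := ha
    simp only [ha, map_zero, AddMonoidHom.zero_apply]
    exact zero_mem _
  | succ p =>
    obtain ⟨e, he⟩ := ha
    obtain rfl : (p + q) + 1 = n := by omega
    refine ⟨cochainCup rfl e (b : Cochain X ℤ q), ?_⟩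
    rw [coboundary_cochainCup, he, mem_cocycles.mp b.2]
    simp

theorem cocycleCup_eq_zero_right {p q n : ℕ} (h : p + q = n) (a : cocycles X A p)
    (b : cocycles X ℤ q) (hb : (b : Cochain X ℤ q) ∈ coboundaries X ℤ q) :
    cocycleCup h a b = 0 := by
  rw [cocycleCup_apply, cohomologyClass_eq_zero]
  cases q with
  | zero =>
    obtain hb : (b : Cochain X ℤ 0) = 0 := hb
    simp only [hb, map_zero]
    exact zero_mem _
  | succ q =>
    obtain ⟨e, he⟩ := hb
    obtain rfl : (p + q) + 1 = n := by omega
    refine ⟨(-1 : ℤ) ^ p • cochainCup rfl (a : Cochain X A p) e, ?_⟩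
    rw [map_zsmul, coboundary_cochainCup, he, mem_cocycles.mp a.2]
    simp [smul_smul, ← mul_pow]

/-- The cup product `Hᵖ(X; A) × H^q(X; ℤ) → Hⁿ(X; A)`, `n = p + q`. -/
def cup {p q n : ℕ} (h : p + q = n) : Cohomology X A p →+ Cohomology X ℤ q →+ Cohomology X A n :=
  Cohomology.lift
    (AddMonoidHom.mk'
      (fun a => Cohomology.lift (cocycleCup h a) (fun b hb => cocycleCup_eq_zero_right h a b hb))
      (fun a a' => by
        refine AddMonoidHom.ext fun c => ?_
        obtain ⟨b, rfl⟩ := cohomologyClass_surjective c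
        simp))
    (fun a ha => by
      refine AddMonoidHom.ext fun c => ?_
      obtain ⟨b, rfl⟩ := cohomologyClass_surjective c
      simp [cocycleCup_eq_zero_left h a b ha])

@[simp] theorem cup_class {p q n : ℕ} (h : p + q = n) (a : cocycles X A p)
    (b : cocycles X ℤ q) : cup h (cohomologyClass a) (cohomologyClass b) = cocycleCup h a b := rfl

/-! ### The Bockstein homomorphism `Hᵖ(X; 𝕋) → Hᵖ⁺¹(X; ℤ)` -/

/-- The change of coefficients on cochains. -/
def Cochain.mapCoeff {A B : Type*} [AddCommGroup A] [AddCommGroup B] (φ : A →+ B) (n : ℕ) :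
    Cochain X A n →+ Cochain X B n where
  toFun f s := φ (f s)
  map_zero' := by funext s; simp
  map_add' f g := by funext s; simp

theorem Cochain.coboundary_mapCoeff {A B : Type*} [AddCommGroup A] [AddCommGroup B] (φ : A →+ B)
    (n : ℕ) (f : Cochain X A n) :
    coboundary n (Cochain.mapCoeff φ n f) = Cochain.mapCoeff φ (n + 1) (coboundary n f) := by
  funext s
  simp [coboundary_apply, Cochain.mapCoeff]

/-- The inclusion `ℤ → ℝ` on cochains. -/
abbrev Cochain.intToReal (n : ℕ) : Cochain X ℤ n →+ Cochain X ℝ n :=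
  Cochain.mapCoeff (Int.castAddHom ℝ) n

/-- The projection `ℝ → 𝕋 = ℝ / ℤ` on cochains. -/
abbrev Cochain.realToCircle (n : ℕ) : Cochain X ℝ n →+ Cochain X UnitAddCircle n :=
  Cochain.mapCoeff (QuotientAddGroup.mk' (AddSubgroup.zmultiples (1 : ℝ))) n

theorem Cochain.intToReal_injective (n : ℕ) :
    Function.Injective (Cochain.intToReal (X := X) n) := by
  intro f g h
  funext s
  have := congrFun h s
  simpa [Cochain.mapCoeff] using this

theorem Cochain.realToCircle_surjective (n : ℕ) :
    Function.Surjective (Cochain.realToCircle (X := X) n) := by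
  intro f
  choose F hF using fun s => QuotientAddGroup.mk'_surjective (AddSubgroup.zmultiples (1 : ℝ)) (f s)
  exact ⟨F, funext hF⟩

theorem Cochain.realToCircle_eq_zero {n : ℕ} {F : Cochain X ℝ n} :
    Cochain.realToCircle n F = 0 ↔ ∃ z, Cochain.intToReal n z = F := by
  constructor
  · intro h
    have h' : ∀ s, ∃ z : ℤ, (z : ℝ) = F s := by
      intro s
      have := congrFun h s
      simp only [Cochain.mapCoeff, AddMonoidHom.coe_mk, ZeroHom.coe_mk, Pi.zero_apply,
        QuotientAddGroup.mk'_apply, QuotientAddGroup.eq_zero_iff,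
        AddSubgroup.mem_zmultiples_iff] at this
      obtain ⟨k, hk⟩ := this
      exact ⟨k, by simpa using hk⟩
    choose z hz using h'
    exact ⟨z, funext hz⟩
  · rintro ⟨z, rfl⟩
    funext s
    simp only [Cochain.mapCoeff, AddMonoidHom.coe_mk, ZeroHom.coe_mk, Pi.zero_apply,
        QuotientAddGroup.mk'_apply, QuotientAddGroup.eq_zero_iff,
        AddSubgroup.mem_zmultiples_iff]
    exact ⟨z s, by simp⟩

/-- `z` represents the Bockstein of the `𝕋`-valued cochain `f`: there is a real lift `F` of `f`
with `d F = z`. -/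
def IsBockstein {p : ℕ} (f : Cochain X UnitAddCircle p) (z : Cochain X ℤ (p + 1)) : Prop :=
  ∃ F : Cochain X ℝ p, Cochain.realToCircle p F = f ∧
    coboundary p F = Cochain.intToReal (p + 1) z

theorem IsBockstein.add {p : ℕ} {f f' : Cochain X UnitAddCircle p} {z z' : Cochain X ℤ (p + 1)}
    (h : IsBockstein f z) (h' : IsBockstein f' z') : IsBockstein (f + f') (z + z') := by
  obtain ⟨F, h1, h2⟩ := h
  obtain ⟨F', h1', h2'⟩ := h'
  exact ⟨F + F', by rw [map_add, h1, h1'], by rw [map_add, map_add, h2, h2']⟩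

theorem IsBockstein.sub {p : ℕ} {f f' : Cochain X UnitAddCircle p} {z z' : Cochain X ℤ (p + 1)}
    (h : IsBockstein f z) (h' : IsBockstein f' z') : IsBockstein (f - f') (z - z') := by
  obtain ⟨F, h1, h2⟩ := h
  obtain ⟨F', h1', h2'⟩ := h'
  exact ⟨F - F', by rw [map_sub, h1, h1'], by rw [map_sub, map_sub, h2, h2']⟩

theorem exists_isBockstein {p : ℕ} (f : cocycles X UnitAddCircle p) :
    ∃ z, IsBockstein (f : Cochain X UnitAddCircle p) z := by
  obtain ⟨F, hF⟩ := Cochain.realToCircle_surjective p (f : Cochain X UnitAddCircle p)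
  have : Cochain.realToCircle (p + 1) (coboundary p F) = 0 := by
    rw [← Cochain.coboundary_mapCoeff, hF, mem_cocycles.mp f.2]
  obtain ⟨z, hz⟩ := Cochain.realToCircle_eq_zero.mp this
  exact ⟨z, F, hF, hz.symm⟩

theorem IsBockstein.mem_cocycles {p : ℕ} {f : Cochain X UnitAddCircle p}
    {z : Cochain X ℤ (p + 1)} (h : IsBockstein f z) : z ∈ cocycles X ℤ (p + 1) := by
  obtain ⟨F, -, h2⟩ := h
  rw [AbelianDuality.mem_cocycles]
  apply Cochain.intToReal_injective
  rw [← Cochain.coboundary_mapCoeff, ← h2, coboundary_coboundary, map_zero]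

theorem IsBockstein.mem_coboundaries {p : ℕ} {f : Cochain X UnitAddCircle p}
    {z : Cochain X ℤ (p + 1)} (h : IsBockstein f z) (hf : f ∈ coboundaries X UnitAddCircle p) :
    z ∈ coboundaries X ℤ (p + 1) := by
  obtain ⟨F, h1, h2⟩ := h
  have key : ∃ E : Cochain X ℝ p, coboundary p E = 0 ∧ Cochain.realToCircle p (F - E) = 0 := by
    cases p with
    | zero =>
      obtain rfl : f = 0 := hf
      exact ⟨0, by simp, by simpa using h1⟩
    | succ p =>
      obtain ⟨e, he⟩ := hf
      obtain ⟨E, hE⟩ := Cochain.realToCircle_surjective p e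
      exact ⟨coboundary p E, coboundary_coboundary p E, by
        rw [map_sub, h1, ← Cochain.coboundary_mapCoeff, hE, he, sub_self]⟩
  obtain ⟨E, hE, hFE⟩ := key
  obtain ⟨w, hw⟩ := Cochain.realToCircle_eq_zero.mp hFE
  refine ⟨w, ?_⟩
  apply Cochain.intToReal_injective
  rw [← Cochain.coboundary_mapCoeff, hw, map_sub, hE, sub_zero, h2]

/-- The Bockstein homomorphism of `0 → ℤ → ℝ → 𝕋 → 0` on cocycles. -/
def cocycleBockstein (p : ℕ) : cocycles X UnitAddCircle p →+ Cohomology X ℤ (p + 1) :=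
  AddMonoidHom.mk'
    (fun f => cohomologyClass ⟨(exists_isBockstein f).choose,
      (exists_isBockstein f).choose_spec.mem_cocycles⟩)
    (fun f f' => by
      rw [← map_add, ← sub_eq_zero, ← map_sub, cohomologyClass_eq_zero]
      have h := (exists_isBockstein (f + f')).choose_spec.sub
        ((exists_isBockstein f).choose_spec.add (exists_isBockstein f').choose_spec)
      refine h.mem_coboundaries ?_
      simp only [AddSubgroup.coe_add, sub_self]
      exact zero_mem _)

/-- The Bockstein homomorphism `Hᵖ(X; 𝕋) → Hᵖ⁺¹(X; ℤ)`. -/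
def bockstein (p : ℕ) : Cohomology X UnitAddCircle p →+ Cohomology X ℤ (p + 1) :=
  Cohomology.lift (cocycleBockstein p) (fun f hf => by
    rw [cocycleBockstein, AddMonoidHom.mk'_apply, cohomologyClass_eq_zero]
    exact (exists_isBockstein f).choose_spec.mem_coboundaries hf)

theorem bockstein_class {p : ℕ} (f : cocycles X UnitAddCircle p) (z : cocycles X ℤ (p + 1))
    (h : IsBockstein (f : Cochain X UnitAddCircle p) (z : Cochain X ℤ (p + 1))) :
    bockstein p (cohomologyClass f) = cohomologyClass z := by
  rw [bockstein, Cohomology.lift_class, cocycleBockstein, AddMonoidHom.mk'_apply, ← sub_eq_zero,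
    ← map_sub, cohomologyClass_eq_zero]
  refine ((exists_isBockstein f).choose_spec.sub h).mem_coboundaries ?_
  rw [sub_self]
  exact zero_mem _

/-- A cohomology class is torsion only if some positive multiple of a representative is exact. -/
theorem exists_nsmul_mem_coboundaries {n : ℕ} (z : cocycles X ℤ n)
    (h : cohomologyClass z ∈ TorsionCohomology X n) :
    ∃ N : ℕ, 0 < N ∧ N • (z : Cochain X ℤ n) ∈ coboundaries X ℤ n := by
  obtain ⟨N, hN, h0⟩ := (isOfFinAddOrder_iff_nsmul_eq_zero).mp
    (show IsOfFinAddOrder (cohomologyClass z) from h)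
  refine ⟨N, hN, ?_⟩
  rw [← map_nsmul, cohomologyClass_eq_zero] at h0
  simpa using h0

theorem exists_bockstein_eq {p : ℕ} (t : TorsionCohomology X (p + 1)) :
    ∃ u, bockstein p u = (t : Cohomology X ℤ (p + 1)) := by
  obtain ⟨t, ht⟩ := t
  obtain ⟨z, rfl⟩ := cohomologyClass_surjective t
  obtain ⟨N, hN, e, he⟩ := exists_nsmul_mem_coboundaries z ht
  have hN' : (N : ℝ) ≠ 0 := by positivity
  let F : Cochain X ℝ p := fun s => (N : ℝ)⁻¹ * e s
  have hF : coboundary p F = Cochain.intToReal (p + 1) z := by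
    funext s
    have h1 := congrArg (Int.cast : ℤ → ℝ) (congrFun he s)
    simp only [coboundary_apply, Pi.smul_apply] at h1
    push_cast at h1
    simp only [coboundary_apply, F, Cochain.mapCoeff]
    simp only [smul_eq_mul, nsmul_eq_mul, zsmul_eq_mul, Int.cast_mul, Int.cast_pow, Int.cast_neg,
      Int.cast_one, Int.cast_natCast] at h1 ⊢
    simp only [AddMonoidHom.coe_mk, ZeroHom.coe_mk, Int.coe_castAddHom]
    rw [eq_comm, ← mul_right_inj' hN', ← h1, Finset.mul_sum]
    refine Finset.sum_congr rfl fun i _ => ?_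
    field_simp
  have hf : Cochain.realToCircle p F ∈ cocycles X UnitAddCircle p := by
    rw [mem_cocycles, Cochain.coboundary_mapCoeff, Cochain.realToCircle_eq_zero]
    exact ⟨z, hF.symm⟩
  exact ⟨cohomologyClass ⟨_, hf⟩, bockstein_class ⟨_, hf⟩ z ⟨F, rfl, hF⟩⟩

theorem cup_eq_zero_of_bockstein_eq_zero {p q n : ℕ} (h : p + q = n)
    {u : Cohomology X UnitAddCircle p} (hu : bockstein p u = 0) (t : TorsionCohomology X q) :
    cup h u (t : Cohomology X ℤ q) = 0 := by
  obtain ⟨f, rfl⟩ := cohomologyClass_surjective u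
  obtain ⟨z, F, hF, hz⟩ := exists_isBockstein f
  have hzc : IsBockstein (f : Cochain X UnitAddCircle p) z := ⟨F, hF, hz⟩
  rw [bockstein_class f ⟨z, hzc.mem_cocycles⟩ hzc, cohomologyClass_eq_zero] at hu
  obtain ⟨w, hw⟩ := hu
  obtain ⟨t, ht⟩ := t
  obtain ⟨b, rfl⟩ := cohomologyClass_surjective t
  obtain ⟨N, hN, hb⟩ := exists_nsmul_mem_coboundaries b ht
  have hN' : (N : ℝ) ≠ 0 := by positivity
  -- a real cocycle lifting `f`
  let G : Cochain X ℝ p := (N : ℝ)⁻¹ • (F - Cochain.intToReal p w)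
  have hG : coboundary p (F - Cochain.intToReal p w) = 0 := by
    rw [map_sub, hz, Cochain.coboundary_mapCoeff, hw, sub_self]
  have hG' : coboundary p G = 0 := by
    funext s
    have := congrFun hG s
    simp only [coboundary_apply] at this ⊢
    simp only [G, Pi.smul_apply, smul_comm _ (N : ℝ)⁻¹, ← Finset.smul_sum, this]
    simp
  have hNG : ∀ s, (N : ℝ) * G s = F s - w s := by
    intro s
    simp only [G, Pi.smul_apply, smul_eq_mul]
    rw [mul_inv_cancel_left₀ hN']
    rfl
  have hcup : cochainCup h (f : Cochain X UnitAddCircle p) (b : Cochain X ℤ q) =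
      Cochain.realToCircle n (cochainCup h G (N • (b : Cochain X ℤ q))) := by
    have h1 : (f : Cochain X UnitAddCircle p) = Cochain.realToCircle p (F - Cochain.intToReal p w) := by
      rw [map_sub, hF, Cochain.realToCircle_eq_zero.mpr ⟨w, rfl⟩, sub_zero]
    rw [h1]
    funext s
    simp only [cochainCup_apply, Cochain.mapCoeff, AddMonoidHom.coe_mk, ZeroHom.coe_mk,
      Pi.smul_apply, Pi.sub_apply]
    rw [← map_zsmul]
    congr 1
    simp only [nsmul_eq_mul, zsmul_eq_mul, Int.cast_mul, Int.cast_natCast]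
    rw [mul_comm (N : ℝ), mul_assoc, hNG]
    rfl
  rw [cup_class, cocycleCup_apply, cohomologyClass_eq_zero]
  simp only [hcup]
  cases q with
  | zero =>
    obtain hb : N • (b : Cochain X ℤ 0) = 0 := hb
    rw [hb, map_zero, map_zero]
    exact zero_mem _
  | succ q =>
    obtain ⟨e, he⟩ := hb
    obtain rfl : (p + q) + 1 = n := by omega
    refine ⟨Cochain.realToCircle (p + q) ((-1 : ℤ) ^ p • cochainCup rfl G e), ?_⟩
    rw [Cochain.coboundary_mapCoeff, map_zsmul, coboundary_cochainCup, he, hG', map_zero,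
      AddMonoidHom.zero_apply, zero_add, smul_smul, ← mul_pow, neg_mul_neg, one_mul, one_pow,
      one_smul]

end Cohomology

/-! ### Singular homology and evaluation -/

section Homology

variable (X : Type u) [TopologicalSpace X]

/-- Singular `n`-chains with integer coefficients. -/
abbrev Chain (n : ℕ) : Type u := SingularSimplex X n →₀ ℤ

variable {X}

/-- The boundary operator `∂ s = ∑ᵢ (-1)ⁱ ∂ᵢ s`. -/
def boundary (n : ℕ) : Chain X (n + 1) →+ Chain X n :=
  Finsupp.liftAddHom fun s =>
    zmultiplesHom _ (∑ i : Fin (n + 2), Finsupp.single (face i s) ((-1 : ℤ) ^ (i : ℕ)))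

variable (X)

/-- Singular cycles. -/
def cycles : (n : ℕ) → AddSubgroup (Chain X n)
  | 0 => ⊤
  | n + 1 => (boundary n).ker

/-- Singular boundaries. -/
def boundaries (n : ℕ) : AddSubgroup (Chain X n) := (boundary n).range

/-- Singular homology `H_n(X; ℤ)`. -/
abbrev Homology (n : ℕ) : Type u :=
  cycles X n ⧸ (boundaries X n).addSubgroupOf (cycles X n)

variable {X} {A : Type v} [AddCommGroup A]

/-- Evaluation of a cochain on chains, `f(∑ mₛ s) = ∑ mₛ f(s)`. -/
def cochainEval {n : ℕ} : Cochain X A n →+ Chain X n →+ A :=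
  AddMonoidHom.mk' (fun f => Finsupp.liftAddHom fun s => zmultiplesHom A (f s))
    (fun f g => by ext s; simp)

@[simp] theorem cochainEval_single {n : ℕ} (f : Cochain X A n) (s : SingularSimplex X n) (m : ℤ) :
    cochainEval f (Finsupp.single s m) = m • f s := by
  simp [cochainEval]

theorem cochainEval_boundary {n : ℕ} (f : Cochain X A n) (c : Chain X (n + 1)) :
    cochainEval f (boundary n c) = cochainEval (coboundary n f) c := by
  induction c using Finsupp.induction_linear with
  | zero => simp
  | add c c' h h' => simp [h, h']
  | single s m =>
    simp [boundary, coboundary_apply]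

/-- The evaluation pairing `Hⁿ(X; A) × H_n(X; ℤ) → A`. -/
def cohomologyEval {n : ℕ} : Cohomology X A n →+ Homology X n →+ A :=
  Cohomology.lift
    (AddMonoidHom.mk'
      (fun f => QuotientAddGroup.lift _ ((cochainEval (f : Cochain X A n)).comp (cycles X n).subtype)
        (by
          rintro ⟨c, hc⟩ hb
          obtain ⟨e, rfl⟩ := AddSubgroup.mem_addSubgroupOf.mp hb
          simp [cochainEval_boundary, mem_cocycles.mp f.2]))
      (fun f g => by
        ext c
        simp))
    (fun f hf => by
      ext c
      obtain ⟨c, hc⟩ := c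
      simp only [AddMonoidHom.mk'_apply, AddMonoidHom.coe_comp, Function.comp_apply,
        QuotientAddGroup.mk'_apply, QuotientAddGroup.lift_mk, AddSubgroup.subtype_apply,
        AddMonoidHom.zero_apply]
      cases n with
      | zero =>
        obtain hf : (f : Cochain X A 0) = 0 := hf
        simp [hf]
      | succ n =>
        obtain ⟨e, he⟩ := hf
        rw [← he, ← cochainEval_boundary, show boundary n c = 0 from hc, map_zero])

end Homology

/-! ### The torsion linking pairing and the torsion topological sector -/

section Linking

variable {S : Type u} [TopologicalSpace S]

/-- `(t, t') ↦ u ⌣ t'`, where `u ∈ Hᵖ(S; 𝕋)` is any class with Bockstein `t`. -/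
def linkingClass {p q n : ℕ} (h : p + q = n) :
    TorsionCohomology S (p + 1) →+ TorsionCohomology S q →+ Cohomology S UnitAddCircle n :=
  AddMonoidHom.mk'
    (fun t => (cup h (exists_bockstein_eq t).choose).comp (TorsionCohomology S q).subtype)
    (fun t t' => by
      ext x
      have h1 := (exists_bockstein_eq (t + t')).choose_spec
      have h2 := (exists_bockstein_eq t).choose_spec
      have h3 := (exists_bockstein_eq t').choose_spec
      have := cup_eq_zero_of_bockstein_eq_zero h
        (u := (exists_bockstein_eq (t + t')).choose -
          ((exists_bockstein_eq t).choose + (exists_bockstein_eq t').choose))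
        (by rw [map_sub, map_add, h1, h2, h3]; simp) x
      rw [map_sub, map_add, AddMonoidHom.sub_apply, AddMonoidHom.add_apply, sub_eq_zero] at this
      exact this)

/-- The defining property: any `u` with Bockstein `t` computes the class. -/
theorem linkingClass_eq {p q n : ℕ} (h : p + q = n) (t : TorsionCohomology S (p + 1))
    (t' : TorsionCohomology S q) (u : Cohomology S UnitAddCircle p)
    (hu : bockstein p u = (t : Cohomology S ℤ (p + 1))) :
    linkingClass h t t' = cup h u (t' : Cohomology S ℤ q) := by
  have h2 := (exists_bockstein_eq t).choose_spec
  have := cup_eq_zero_of_bockstein_eq_zero h (u := (exists_bockstein_eq t).choose - u)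
        (by rw [map_sub, h2, hu, sub_self]) t'
  rw [map_sub, AddMonoidHom.sub_apply, sub_eq_zero] at this
  exact this

/-- The `𝕋`-valued torsion pairing `⟨t, t'⟩ = (u ⌣ t')[S]` between `Hᵖ_tor(S; ℤ)` and
`H^q_tor(S; ℤ)`, `p + q = n + 1`, relative to a class `[S] ∈ H_n(S; ℤ)`; here `u` is any class in
`Hᵖ⁻¹(S; 𝕋)` with Bockstein `t`. For `p = 0` the group `H⁰_tor(S; ℤ)` vanishes and so does the
pairing. -/
def torsionPairing {n : ℕ} (c : Homology S n) : (p q : ℕ) → p + q = n + 1 →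
    TorsionCohomology S p →+ TorsionCohomology S q →+ UnitAddCircle
  | 0, _, _ => 0
  | p + 1, q, h =>
    AddMonoidHom.mk'
      (fun t => ((cohomologyEval (X := S) (A := UnitAddCircle) (n := n)).flip c).comp
        (linkingClass (p := p) (q := q) (n := n) (by omega) t))
      (fun t t' => by ext x; simp)

/-- A presymplectic form on an abelian group: an antisymmetric bi-homomorphism into `𝕋`. -/
structure PresymplecticForm (G : Type*) [AddCommGroup G] where
  /-- the underlying bi-homomorphism -/
  toHom : G →+ G →+ UnitAddCircle
  antisymm : ∀ x y, toHom x y = -toHom y x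

/-- The group `H^{k,l}_tor(X; ℤ) = Hᵏ_tor(X; ℤ) × Hˡ_tor(X; ℤ)`. For a spacetime `M` of dimension
`m` and `l = m - k` this is the torsion topological sector `Topᵏ_tor(M)`. -/
abbrev TopTor (X : Type u) [TopologicalSpace X] (k l : ℕ) : Type u :=
  TorsionCohomology X k × TorsionCohomology X l

/-- Pullback on `H^{k,l}_tor`. -/
def TopTor.pullback {X : Type u} {Y : Type v} [TopologicalSpace X] [TopologicalSpace Y]
    (i : C(X, Y)) (k l : ℕ) : TopTor Y k l →+ TopTor X k l :=
  (TorsionCohomology.pullback i k).prodMap (TorsionCohomology.pullback i l)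

/-- The bi-homomorphism `((t, t̃), (t', t̃')) ↦ ⟨t̃, t'⟩`. -/
def crossPairing {n : ℕ} (c : Homology S n) (k l : ℕ) (h : k + l = n + 1) :
    TopTor S k l →+ TopTor S k l →+ UnitAddCircle :=
  ((torsionPairing c l k (by omega)).comp (AddMonoidHom.snd _ _)).compr₂ (AddMonoidHom.id _)
    |>.compl₂ (AddMonoidHom.fst _ _)

/-- `σ((t, t̃), (t', t̃')) = ⟨t̃, t'⟩ - ⟨t̃', t⟩` on `H^{k,l}_tor(S; ℤ)`. -/
def sigmaTorSurface {n : ℕ} (c : Homology S n) (k l : ℕ) (h : k + l = n + 1) :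
    PresymplecticForm (TopTor S k l) where
  toHom := crossPairing c k l h - (crossPairing c k l h).flip
  antisymm x y := by simp

theorem sigmaTorSurface_apply {n : ℕ} (c : Homology S n) (k l : ℕ) (h : k + l = n + 1)
    (x y : TopTor S k l) : (sigmaTorSurface c k l h).toHom x y =
      torsionPairing c l k (by omega) x.2 y.1 - torsionPairing c l k (by omega) y.2 x.1 := rfl

/-- Pullback of a presymplectic form along a homomorphism. -/
def PresymplecticForm.pullback {G H : Type*} [AddCommGroup G] [AddCommGroup H]
    (σ : PresymplecticForm H) (φ : G →+ H) : PresymplecticForm G where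
  toHom := (σ.toHom.comp φ).compl₂ φ
  antisymm x y := by simpa using σ.antisymm (φ x) (φ y)

/-- The duality `ζ_tor : H^{k,l}_tor → H^{l,k}_tor`, `(t, t̃) ↦ (t̃, (-1)^{kl+1} t)`. -/
def zetaTor (X : Type u) [TopologicalSpace X] (k l : ℕ) : TopTor X k l →+ TopTor X l k where
  toFun x := (x.2, (-1 : ℤ) ^ (k * l + 1) • x.1)
  map_zero' := by simp
  map_add' x y := by simp

end Linking

/-! ## Weyl quantization -/

section Phase

variable {G : Type u} [AddCommGroup G] (σ : PresymplecticForm G)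

/-- The phase `exp(2πi σ(x, y))`. -/
def PresymplecticForm.phase (x y : G) : ℂ := (AddCircle.toCircle (σ.toHom x y) : Circle)

namespace PresymplecticForm

theorem phase_add_left (x y z : G) : σ.phase (x + y) z = σ.phase x z * σ.phase y z := by
  simp [phase, AddCircle.toCircle_add]

theorem phase_add_right (x y z : G) : σ.phase x (y + z) = σ.phase x y * σ.phase x z := by
  simp [phase, AddCircle.toCircle_add]

@[simp] theorem phase_zero_left (x : G) : σ.phase 0 x = 1 := by simp [phase]

@[simp] theorem phase_zero_right (x : G) : σ.phase x 0 = 1 := by simp [phase]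

@[simp] theorem norm_phase (x y : G) : ‖σ.phase x y‖ = 1 := Circle.norm_coe _

theorem phase_neg_neg (x y : G) : σ.phase (-x) (-y) = σ.phase x y := by simp [phase]

theorem star_phase (x y : G) : star (σ.phase x y) = σ.phase y x := by
  rw [phase, phase, σ.antisymm y x, AddCircle.toCircle_neg, Circle.coe_inv_eq_conj]
  rfl

end PresymplecticForm

end Phase

/-- The underlying space of the `*`-algebra `𝒜(G)`: finite linear combinations of the symbols
`W(x)`, `x ∈ G`. The multiplication and involution below are determined by
`W(x) W(y) = exp(2πi σ(x, y)) W(x + y)` and `W(x)* = W(-x)`. -/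
def WeylPre {G : Type u} [AddCommGroup G] (_σ : PresymplecticForm G) : Type u := G →₀ ℂ

namespace WeylPre

variable {G : Type u} [AddCommGroup G] {σ : PresymplecticForm G}

instance : AddCommGroup (WeylPre σ) := inferInstanceAs (AddCommGroup (G →₀ ℂ))
instance : Module ℂ (WeylPre σ) := inferInstanceAs (Module ℂ (G →₀ ℂ))

/-- The element `α W(x)`. -/
def single (x : G) (α : ℂ) : WeylPre σ := Finsupp.single x α

/-- The coefficient of `W(x)`. -/
def coeff (a : WeylPre σ) : G →₀ ℂ := a

@[elab_as_elim]
theorem induction {p : WeylPre σ → Prop} (a : WeylPre σ) (zero : p 0)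
    (add : ∀ a b, p a → p b → p (a + b)) (single : ∀ x α, p (single x α)) : p a :=
  Finsupp.induction_linear (motive := p) a zero add single

theorem single_add (x : G) (α β : ℂ) :
    (single x (α + β) : WeylPre σ) = single x α + single x β := Finsupp.single_add x α β

theorem smul_single (x : G) (c α : ℂ) : c • (single x α : WeylPre σ) = single x (c * α) :=
  Finsupp.smul_single c x α

variable (σ) in
/-- Left multiplication by `W(x)`, namely `W(y) ↦ exp(2πi σ(x, y)) W(x + y)`. -/
def mulBasis (x : G) : WeylPre σ →ₗ[ℂ] WeylPre σ :=
  Finsupp.linearCombination ℂ (M := WeylPre σ) fun y => single (x + y) (σ.phase x y)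

variable (σ) in
/-- The multiplication of `𝒜(G)` as a bilinear map. -/
def mulLin : WeylPre σ →ₗ[ℂ] WeylPre σ →ₗ[ℂ] WeylPre σ :=
  Finsupp.linearCombination ℂ (M := WeylPre σ →ₗ[ℂ] WeylPre σ) (mulBasis σ)

theorem mulLin_single (x y : G) (α β : ℂ) :
    mulLin σ (single x α) (single y β) = single (x + y) (α * β * σ.phase x y) := by
  have h1 : mulLin σ (single x α) = α • mulBasis σ x :=
    Finsupp.linearCombination_single ℂ α x
  have h2 : mulBasis σ x (single y β) = β • (single (x + y) (σ.phase x y) : WeylPre σ) :=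
    Finsupp.linearCombination_single ℂ β y
  rw [h1, LinearMap.smul_apply, h2, smul_single, smul_single, mul_assoc]

instance : Mul (WeylPre σ) := ⟨fun a b => mulLin σ a b⟩
instance : One (WeylPre σ) := ⟨single 0 1⟩

theorem mul_def (a b : WeylPre σ) : a * b = mulLin σ a b := rfl
theorem one_def : (1 : WeylPre σ) = single 0 1 := rfl

/-- `αW(x) βW(y) = αβ exp(2πi σ(x, y)) W(x + y)`. -/
theorem single_mul_single (x y : G) (α β : ℂ) :
    (single x α * single y β : WeylPre σ) = single (x + y) (α * β * σ.phase x y) :=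
  mulLin_single x y α β

instance : Ring (WeylPre σ) where
  __ := (inferInstance : AddCommGroup (WeylPre σ))
  left_distrib a b c := by simp [mul_def]
  right_distrib a b c := by simp [mul_def]
  zero_mul a := by simp [mul_def]
  mul_zero a := by simp [mul_def]
  mul_assoc a b c := by
    induction a using induction with
    | zero => simp [mul_def]
    | add a a' h h' => simp only [mul_def, map_add, LinearMap.add_apply] at h h' ⊢; rw [h, h']
    | single x α =>
      induction b using induction with
      | zero => simp [mul_def]
      | add a a' h h' => simp only [mul_def, map_add, LinearMap.add_apply] at h h' ⊢; rw [h, h']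
      | single y β =>
        induction c using induction with
        | zero => simp [mul_def]
        | add a a' h h' => simp only [mul_def, map_add] at h h' ⊢; rw [h, h']
        | single z γ =>
          simp only [single_mul_single, add_assoc, σ.phase_add_left, σ.phase_add_right]
          congr 1
          ring
  one_mul a := by
    induction a using induction with
    | zero => simp [mul_def]
    | add a a' h h' => simp only [mul_def, map_add] at h h' ⊢; rw [h, h']
    | single x α => simp [one_def, single_mul_single]
  mul_one a := by
    induction a using induction with
    | zero => simp [mul_def]
    | add a a' h h' => simp only [mul_def, map_add, LinearMap.add_apply] at h h' ⊢; rw [h, h']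
    | single x α => simp [one_def, single_mul_single]

instance : Algebra ℂ (WeylPre σ) :=
  Algebra.ofModule (fun c a b => by simp [mul_def]) (fun c a b => by simp [mul_def])

/-- The involution, `(αW(x))* = ᾱ W(-x)`, as an additive map. -/
def starHom : WeylPre σ →+ WeylPre σ :=
  Finsupp.liftAddHom (M := ℂ) (N := WeylPre σ)
    fun x => (Finsupp.singleAddHom (-x) : ℂ →+ (G →₀ ℂ)).comp (starAddEquiv : ℂ ≃+ ℂ).toAddMonoidHom

theorem starHom_single (x : G) (α : ℂ) :
    starHom (single x α : WeylPre σ) = single (-x) (star α) := by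
  unfold starHom single
  exact (Finsupp.liftAddHom_apply_single (N := WeylPre σ) _ x α).trans rfl

instance : Star (WeylPre σ) := ⟨starHom⟩

theorem star_def (a : WeylPre σ) : star a = starHom a := rfl

theorem star_single (x : G) (α : ℂ) :
    star (single x α : WeylPre σ) = single (-x) (star α) := starHom_single x α

instance : StarRing (WeylPre σ) where
  star_involutive a := by
    induction a using induction with
    | zero => simp [star_def]
    | add a a' h h' => simp only [star_def, map_add] at h h' ⊢; rw [h, h']
    | single x α => simp [star_single]
  star_add a b := by simp [star_def]
  star_mul a b := by
    induction a using induction with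
    | zero => simp [star_def]
    | add a a' h h' => simp only [star_def, map_add, add_mul, mul_add] at h h' ⊢; rw [h, h']
    | single x α =>
      induction b using induction with
      | zero => simp [star_def]
      | add a a' h h' => simp only [star_def, map_add, add_mul, mul_add] at h h' ⊢; rw [h, h']
      | single y β =>
        simp only [single_mul_single, star_single, star_mul', σ.star_phase, σ.phase_neg_neg,
          neg_add_rev]
        congr 1
        ring

instance : StarModule ℂ (WeylPre σ) where
  star_smul c a := by
    induction a using induction with
    | zero => simp
    | add a a' h h' => simp only [smul_add, star_add] at h h' ⊢; rw [h, h']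
    | single x α => simp [smul_single, star_single]

/-- The norm `‖∑ αⱼ W(gⱼ)‖₁ = ∑ |αⱼ|`. -/
def ell1Norm (a : WeylPre σ) : ℝ := (coeff a).sum fun _ α => ‖α‖

theorem ell1Norm_eq_sum (a : WeylPre σ) (s : Finset G) (h : (coeff a).support ⊆ s) :
    ell1Norm a = ∑ x ∈ s, ‖coeff a x‖ :=
  Finsupp.sum_of_support_subset _ h _ (by simp)

theorem ell1Norm_zero : ell1Norm (0 : WeylPre σ) = 0 := by
  simpa using ell1Norm_eq_sum (0 : WeylPre σ) ∅ (by
    rw [show coeff (0 : WeylPre σ) = 0 from rfl]; simp)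

theorem ell1Norm_nonneg (a : WeylPre σ) : 0 ≤ ell1Norm a :=
  Finset.sum_nonneg fun _ _ => norm_nonneg _

theorem ell1Norm_single (x : G) (α : ℂ) : ell1Norm (single x α : WeylPre σ) = ‖α‖ :=
  Finsupp.sum_single_index (by simp)

theorem ell1Norm_add_le (a b : WeylPre σ) : ell1Norm (a + b) ≤ ell1Norm a + ell1Norm b := by
  classical
  rw [ell1Norm_eq_sum (a + b) ((coeff a).support ∪ (coeff b).support) Finsupp.support_add,
    ell1Norm_eq_sum a _ Finset.subset_union_left, ell1Norm_eq_sum b _ Finset.subset_union_right,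
    ← Finset.sum_add_distrib]
  exact Finset.sum_le_sum fun x _ => norm_add_le (coeff a x) (coeff b x)

theorem ell1Norm_smul (c : ℂ) (a : WeylPre σ) : ell1Norm (c • a) = ‖c‖ * ell1Norm a := by
  rw [ell1Norm_eq_sum (c • a) (coeff a).support (Finsupp.support_smul (b := c) (g := coeff a)),
    ell1Norm_eq_sum a _ subset_rfl, Finset.mul_sum]
  exact Finset.sum_congr rfl fun x _ => norm_mul c (coeff a x)

theorem ell1Norm_neg (a : WeylPre σ) : ell1Norm (-a) = ell1Norm a := by
  have := ell1Norm_smul (-1) a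
  simpa using this

theorem ell1Norm_eq_zero {a : WeylPre σ} (h : ell1Norm a = 0) : a = 0 := by
  rw [ell1Norm_eq_sum a _ subset_rfl, Finset.sum_eq_zero_iff_of_nonneg
    fun _ _ => norm_nonneg _] at h
  refine Finsupp.ext (f := coeff a) (g := 0) fun x => ?_
  by_contra hx
  exact hx (norm_eq_zero.mp (h x (Finsupp.mem_support_iff.mpr hx)))

theorem eq_sum_single (a : WeylPre σ) :
    a = ∑ x ∈ (coeff a).support, (single x (coeff a x) : WeylPre σ) :=
  (Finsupp.sum_single (coeff a)).symm

theorem ell1Norm_sum_le {ι : Type*} (s : Finset ι) (f : ι → WeylPre σ) :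
    ell1Norm (∑ i ∈ s, f i) ≤ ∑ i ∈ s, ell1Norm (f i) := by
  classical
  induction s using Finset.induction_on with
  | empty => simp [ell1Norm_zero]
  | insert i s hi ih =>
    rw [Finset.sum_insert hi, Finset.sum_insert hi]
    exact (ell1Norm_add_le _ _).trans (by gcongr)

theorem ell1Norm_mul_le (a b : WeylPre σ) : ell1Norm (a * b) ≤ ell1Norm a * ell1Norm b := by
  rw [ell1Norm_eq_sum a _ subset_rfl, ell1Norm_eq_sum b _ subset_rfl, Finset.sum_mul_sum]
  nth_rw 1 [eq_sum_single a, eq_sum_single b, Finset.sum_mul_sum]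
  refine (ell1Norm_sum_le _ _).trans (Finset.sum_le_sum fun x _ => ?_)
  refine (ell1Norm_sum_le _ _).trans (Finset.sum_le_sum fun y _ => ?_)
  rw [single_mul_single, ell1Norm_single]
  simp

theorem ell1Norm_star_le (a : WeylPre σ) : ell1Norm (star a) ≤ ell1Norm a := by
  nth_rw 1 [eq_sum_single a]
  rw [star_sum, ell1Norm_eq_sum a _ subset_rfl]
  refine (ell1Norm_sum_le _ _).trans (Finset.sum_le_sum fun x _ => ?_)
  rw [star_single, ell1Norm_single, norm_star]

instance : NormedRing (WeylPre σ) :=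
  RingNorm.toNormedRing
    { toFun := ell1Norm
      map_zero' := ell1Norm_zero
      add_le' := ell1Norm_add_le
      neg' := ell1Norm_neg
      mul_le' := ell1Norm_mul_le
      eq_zero_of_map_eq_zero' := fun _ => ell1Norm_eq_zero }

theorem norm_def (a : WeylPre σ) : ‖a‖ = ell1Norm a := rfl

instance : NormedAlgebra ℂ (WeylPre σ) where
  norm_smul_le c a := (ell1Norm_smul c a).le

instance : NormedStarGroup (WeylPre σ) where
  norm_star_le a := ell1Norm_star_le a

end WeylPre

/-! ### Completion of a seminormed `*`-algebra -/

section StarCompletion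

open UniformSpace

variable {A : Type u} [SeminormedRing A] [StarRing A]

instance : Star (Completion A) := ⟨Completion.map star⟩

theorem completion_continuous_star : Continuous (star : Completion A → Completion A) :=
  Completion.continuous_map

variable [NormedStarGroup A]

theorem completion_coe_star (a : A) : ((star a : A) : Completion A) = star (a : Completion A) :=
  (Completion.map_coe star_isometry.uniformContinuous a).symm

instance : StarRing (Completion A) where
  star_involutive a := by
    induction a using Completion.induction_on with
    | hp => exact isClosed_eq (completion_continuous_star.comp completion_continuous_star)
              continuous_id
    | ih a => rw [← completion_coe_star, ← completion_coe_star, star_star]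
  star_add a b := by
    induction a, b using Completion.induction_on₂ with
    | hp => exact isClosed_eq (completion_continuous_star.comp (by fun_prop))
              ((completion_continuous_star.comp continuous_fst).add
                (completion_continuous_star.comp continuous_snd))
    | ih a b =>
      rw [← Completion.coe_add]
      simp only [← completion_coe_star]
      rw [star_add, Completion.coe_add]
  star_mul a b := by
    induction a, b using Completion.induction_on₂ with
    | hp => exact isClosed_eq (completion_continuous_star.comp (by fun_prop))
              ((completion_continuous_star.comp continuous_snd).mul
                (completion_continuous_star.comp continuous_fst))
    | ih a b =>
      rw [← Completion.coe_mul]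
      simp only [← completion_coe_star]
      rw [star_mul, Completion.coe_mul]

instance : NormedStarGroup (Completion A) where
  norm_star_le a := by
    induction a using Completion.induction_on with
    | hp => exact isClosed_le (continuous_norm.comp completion_continuous_star) continuous_norm
    | ih a => rw [← completion_coe_star, Completion.norm_coe, Completion.norm_coe, norm_star]

variable [NormedAlgebra ℂ A]

instance : NormedAlgebra ℂ (Completion A) where
  norm_smul_le := norm_smul_le

instance [StarModule ℂ A] : StarModule ℂ (Completion A) where
  star_smul c a := by
    induction a using Completion.induction_on with
    | hp =>
      have h1 : Continuous fun a : Completion A => star (c • a) :=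
        completion_continuous_star.comp (continuous_const_smul c)
      have h2 : Continuous fun a : Completion A => star c • star a :=
        (continuous_const_smul (star c)).comp completion_continuous_star
      exact isClosed_eq h1 h2
    | ih a =>
      rw [← Completion.coe_smul, ← completion_coe_star, ← completion_coe_star, star_smul,
        Completion.coe_smul]

end StarCompletion

/-- The Banach `*`-algebra `ℬ(G)`: the completion of `𝒜(G)` in the norm `‖·‖₁`. -/
abbrev WeylBanach {G : Type u} [AddCommGroup G] (σ : PresymplecticForm G) : Type u :=
  UniformSpace.Completion (WeylPre σ)

/-! ### The enveloping C*-algebra of a Banach `*`-algebra -/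

section Envelope

variable (B : Type u) [NormedRing B] [StarRing B] [NormedAlgebra ℂ B]

/-- C*-seminorms `p` on a Banach `*`-algebra; those are exactly the functions `b ↦ ‖π(b)‖` for
`π` a `*`-representation on a Hilbert space. (The bound `p ≤ ‖·‖` holds for every such `π` when
`B` is complete with isometric involution.) -/
structure CStarSeminorm extends Seminorm ℂ B where
  mul_le' : ∀ a b, toFun (a * b) ≤ toFun a * toFun b
  star_mul_self' : ∀ a, toFun (star a * a) = toFun a * toFun a
  le_norm' : ∀ a, toFun a ≤ ‖a‖

variable {B}

theorem CStarSeminorm.star_le (p : CStarSeminorm B) (a : B) :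
    p.toSeminorm (star a) ≤ p.toSeminorm a := by
  have h1 : p.toSeminorm (star (star a) * star a) = p.toSeminorm (star a) * p.toSeminorm (star a) :=
    p.star_mul_self' (star a)
  have h2 : p.toSeminorm (star (star a) * star a) ≤ p.toSeminorm a * p.toSeminorm (star a) := by
    rw [star_star]; exact p.mul_le' a (star a)
  rcases (apply_nonneg p.toSeminorm (star a)).eq_or_lt with h | h
  · rw [← h]; exact apply_nonneg _ _
  · exact le_of_mul_le_mul_right (h1 ▸ h2) h

instance : Nonempty (CStarSeminorm B) :=
  ⟨{ (0 : Seminorm ℂ B) with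
      mul_le' := fun a b => by
        change (0 : Seminorm ℂ B) (a * b) ≤ (0 : Seminorm ℂ B) a * (0 : Seminorm ℂ B) b
        simp
      star_mul_self' := fun a => by
        change (0 : Seminorm ℂ B) (star a * a) = (0 : Seminorm ℂ B) a * (0 : Seminorm ℂ B) a
        simp
      le_norm' := fun a => by
        change (0 : Seminorm ℂ B) a ≤ ‖a‖
        simp }⟩

/-- The largest C*-seminorm, `b ↦ sup ‖π(b)‖`. -/
def maxCStarSeminorm (b : B) : ℝ := ⨆ p : CStarSeminorm B, p.toSeminorm b

theorem bddAbove_cstarSeminorm (b : B) :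
    BddAbove (Set.range fun p : CStarSeminorm B => p.toSeminorm b) :=
  ⟨‖b‖, by rintro _ ⟨p, rfl⟩; exact p.le_norm' b⟩

theorem le_maxCStarSeminorm (p : CStarSeminorm B) (b : B) :
    p.toSeminorm b ≤ maxCStarSeminorm b := le_ciSup (bddAbove_cstarSeminorm b) p

theorem maxCStarSeminorm_le {b : B} {r : ℝ} (h : ∀ p : CStarSeminorm B, p.toSeminorm b ≤ r) :
    maxCStarSeminorm b ≤ r := ciSup_le h

theorem maxCStarSeminorm_nonneg (b : B) : 0 ≤ maxCStarSeminorm b :=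
  (apply_nonneg _ _).trans (le_maxCStarSeminorm (Classical.arbitrary _) b)

theorem maxCStarSeminorm_mul_le (a b : B) :
    maxCStarSeminorm (a * b) ≤ maxCStarSeminorm a * maxCStarSeminorm b :=
  maxCStarSeminorm_le fun p => (p.mul_le' a b).trans
    (mul_le_mul (le_maxCStarSeminorm p a) (le_maxCStarSeminorm p b) (apply_nonneg p.toSeminorm b)
      (maxCStarSeminorm_nonneg a))

theorem maxCStarSeminorm_star_mul_self (a : B) :
    maxCStarSeminorm a * maxCStarSeminorm a ≤ maxCStarSeminorm (star a * a) := by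
  have h : maxCStarSeminorm a ≤ Real.sqrt (maxCStarSeminorm (star a * a)) :=
    maxCStarSeminorm_le fun p => Real.le_sqrt_of_sq_le (by
      have h1 : p.toSeminorm (star a * a) = p.toSeminorm a * p.toSeminorm a := p.star_mul_self' a
      rw [sq, ← h1]
      exact le_maxCStarSeminorm p _)
  calc _ ≤ Real.sqrt (maxCStarSeminorm (star a * a)) * Real.sqrt (maxCStarSeminorm (star a * a)) :=
        mul_le_mul h h (maxCStarSeminorm_nonneg a) (Real.sqrt_nonneg _)
    _ = _ := Real.mul_self_sqrt (maxCStarSeminorm_nonneg _)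

variable (B) in
/-- A copy of `B`, seminormed by the largest C*-seminorm. -/
def EnvelopePre : Type u := B

instance : Ring (EnvelopePre B) := inferInstanceAs (Ring B)
instance : StarRing (EnvelopePre B) := inferInstanceAs (StarRing B)
instance : Algebra ℂ (EnvelopePre B) := inferInstanceAs (Algebra ℂ B)
instance [StarModule ℂ B] : StarModule ℂ (EnvelopePre B) := inferInstanceAs (StarModule ℂ B)

instance : SeminormedRing (EnvelopePre B) :=
  RingSeminorm.toSeminormedRing (R := EnvelopePre B)
    { toFun := fun b => maxCStarSeminorm (B := B) b
      map_zero' := le_antisymm (maxCStarSeminorm_le fun p => (map_zero p.toSeminorm).le)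
        (maxCStarSeminorm_nonneg _)
      add_le' := fun a b => maxCStarSeminorm_le fun p =>
        (map_add_le_add p.toSeminorm (a : B) (b : B)).trans
          (add_le_add (le_maxCStarSeminorm p _) (le_maxCStarSeminorm p _))
      neg' := fun a => by
        unfold maxCStarSeminorm
        congr 1
        funext p
        exact map_neg_eq_map p.toSeminorm (a : B)
      mul_le' := fun a b => maxCStarSeminorm_mul_le (B := B) a b }

instance : NormedAlgebra ℂ (EnvelopePre B) where
  norm_smul_le c a := maxCStarSeminorm_le (B := B) fun p =>
    (map_smul_eq_mul p.toSeminorm c (a : B)).le.trans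
      (mul_le_mul_of_nonneg_left (le_maxCStarSeminorm p _) (norm_nonneg c))

instance : NormedStarGroup (EnvelopePre B) where
  norm_star_le a := maxCStarSeminorm_le (B := B) fun p =>
    (p.star_le (a : B)).trans (le_maxCStarSeminorm p _)

theorem EnvelopePre.norm_mul_self_le (a : EnvelopePre B) : ‖a‖ * ‖a‖ ≤ ‖star a * a‖ :=
  maxCStarSeminorm_star_mul_self (B := B) a

variable (B) in
/-- The enveloping C*-algebra of a Banach `*`-algebra `B`: the Hausdorff completion of `B` in its
largest C*-seminorm. -/
abbrev EnvelopingCStar : Type u := UniformSpace.Completion (EnvelopePre B)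

instance : CStarRing (EnvelopingCStar B) where
  norm_mul_self_le a := by
    induction a using UniformSpace.Completion.induction_on with
    | hp => exact isClosed_le (continuous_norm.mul continuous_norm)
              (continuous_norm.comp (completion_continuous_star.mul continuous_id))
    | ih a =>
      rw [← completion_coe_star, ← UniformSpace.Completion.coe_mul,
        UniformSpace.Completion.norm_coe, UniformSpace.Completion.norm_coe]
      exact a.norm_mul_self_le

instance [StarModule ℂ B] : CStarAlgebra (EnvelopingCStar B) where

end Envelope

/-- The canonical map from a Banach `*`-algebra to its enveloping C*-algebra. -/
def toEnvelope {B : Type u} [NormedRing B] [StarRing B] [NormedAlgebra ℂ B] (b : B) :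
    EnvelopingCStar B :=
  UniformSpace.Completion.coe' (show EnvelopePre B from b)

/-- The Weyl C*-algebra `𝒲(G) = C*(ℬ(G))` of a presymplectic abelian group. -/
abbrev WeylAlgebra {G : Type u} [AddCommGroup G] (σ : PresymplecticForm G) : Type u :=
  EnvelopingCStar (WeylBanach σ)

/-- The generator `W(x)` of the Weyl C*-algebra. -/
def weyl {G : Type u} [AddCommGroup G] (σ : PresymplecticForm G) (x : G) : WeylAlgebra σ :=
  toEnvelope ((WeylPre.single x 1 : WeylPre σ) : WeylBanach σ)

/-- The Weyl relations `W(x) W(y) = exp(2πi σ(x, y)) W(x + y)`. -/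
theorem weyl_mul {G : Type u} [AddCommGroup G] (σ : PresymplecticForm G) (x y : G) :
    weyl σ x * weyl σ y = σ.phase x y • weyl σ (x + y) := by
  have h : (WeylPre.single x 1 * WeylPre.single y 1 : WeylPre σ) =
      σ.phase x y • WeylPre.single (x + y) 1 := by
    rw [WeylPre.single_mul_single, WeylPre.smul_single]
    simp
  have h2 := congrArg (fun a : WeylPre σ => toEnvelope (a : WeylBanach σ)) h
  simp only [UniformSpace.Completion.coe_mul, UniformSpace.Completion.coe_smul] at h2
  unfold toEnvelope at h2
  exact (UniformSpace.Completion.coe_mul (α := EnvelopePre (WeylBanach σ)) _ _).symm.trans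
    (h2.trans ((UniformSpace.Completion.toComplₗᵢ (𝕜 := ℂ)
      (E := EnvelopePre (WeylBanach σ))).map_smul _ _))

/-- The Weyl relations `W(x)* = W(-x)`. -/
theorem weyl_star {G : Type u} [AddCommGroup G] (σ : PresymplecticForm G) (x : G) :
    star (weyl σ x) = weyl σ (-x) := by
  have h : star (WeylPre.single x 1 : WeylPre σ) = WeylPre.single (-x) 1 := by
    rw [WeylPre.star_single, star_one]
  have h2 := congrArg (fun a : WeylPre σ => toEnvelope (a : WeylBanach σ)) h
  simp only [completion_coe_star] at h2
  exact (completion_coe_star (A := EnvelopePre (WeylBanach σ)) _).symm.trans h2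

/-- `W(0)` is the unit. -/
theorem weyl_zero {G : Type u} [AddCommGroup G] (σ : PresymplecticForm G) : weyl σ 0 = 1 := rfl

/-- A state on a unital C*-algebra: a normalized positive bounded linear functional. -/
def IsState {A : Type u} [CStarAlgebra A] (φ : A →L[ℂ] ℂ) : Prop :=
  φ 1 = 1 ∧ ∀ a, 0 ≤ φ (star a * a)

/-- A positive functional is faithful if `φ(a* a) = 0` only for `a = 0`. -/
def IsFaithful {A : Type u} [CStarAlgebra A] (φ : A →L[ℂ] ℂ) : Prop :=
  ∀ a, φ (star a * a) = 0 → a = 0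

/-! ## Globally hyperbolic spacetimes with a compact spacelike Cauchy surface -/

section Spacetime

open scoped Manifold ContDiff Topology
open Bundle Filter

section Lorentz

variable (d : ℕ) (M : Type u) [TopologicalSpace M] [ChartedSpace (EuclideanSpace ℝ (Fin d)) M]
  [IsManifold (𝓡 d) ∞ M]

/-- A smooth Lorentzian metric, of signature `(-, +, …, +)`: at every point there is a timelike
vector on whose orthogonal complement the metric is positive definite. -/
structure LorentzMetric where
  /-- the metric at a point -/
  val (x : M) : TangentSpace (𝓡 d) x →L[ℝ] TangentSpace (𝓡 d) x →L[ℝ] ℝ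
  symm (x : M) (v w : TangentSpace (𝓡 d) x) : val x v w = val x w v
  signature (x : M) : ∃ v : TangentSpace (𝓡 d) x, val x v v < 0 ∧
    ∀ w : TangentSpace (𝓡 d) x, val x v w = 0 → w ≠ 0 → 0 < val x w w
  contMDiff : ContMDiff (𝓡 d)
    ((𝓡 d).prod 𝓘(ℝ, EuclideanSpace ℝ (Fin d) →L[ℝ] EuclideanSpace ℝ (Fin d) →L[ℝ] ℝ)) ∞
    (fun x => TotalSpace.mk'
      (EuclideanSpace ℝ (Fin d) →L[ℝ] EuclideanSpace ℝ (Fin d) →L[ℝ] ℝ) x (val x))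

/-- A family of vectors is a positively oriented basis. -/
def IsPositiveBasis {d : ℕ} {V : Type*} [AddCommGroup V] [Module ℝ V]
    (o : Orientation ℝ V (Fin d)) (v : Fin d → V) : Prop :=
  ∃ b : Module.Basis (Fin d) ℝ V, ⇑b = v ∧ b.orientation = o

/-- An orientation of a manifold of positive dimension: a choice of orientation of every tangent
space such that around every point there is a positively oriented continuous local frame. -/
structure ManifoldOrientation where
  /-- the orientation of the tangent space at a point -/
  val (x : M) : Orientation ℝ (TangentSpace (𝓡 d) x) (Fin d)
  exists_frame (x₀ : M) : ∃ U ∈ 𝓝 x₀, ∃ X : Fin d → (x : M) → TangentSpace (𝓡 d) x,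
    (∀ i, ContinuousOn (fun x => (⟨x, X i x⟩ : TangentBundle (𝓡 d) M)) U) ∧
    ∀ x ∈ U, IsPositiveBasis (val x) (fun i => X i x)

variable {d M}

/-- A time-orientation, given by a smooth timelike vector field (declared future-directed). -/
structure TimeOrientation (g : LorentzMetric d M) where
  /-- the vector field -/
  val (x : M) : TangentSpace (𝓡 d) x
  contMDiff : ContMDiff (𝓡 d) (𝓡 d).tangent ∞ (fun x => (⟨x, val x⟩ : TangentBundle (𝓡 d) M))
  timelike (x : M) : g.val x (val x) (val x) < 0

/-- Timelike curves, parametrized by the real line. -/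
def IsTimelikeCurve (g : LorentzMetric d M) (γ : ℝ → M) : Prop :=
  ContMDiff 𝓘(ℝ, ℝ) (𝓡 d) 1 γ ∧
    ∀ t : ℝ, g.val (γ t) (mfderiv 𝓘(ℝ, ℝ) (𝓡 d) γ t (1 : ℝ))
      (mfderiv 𝓘(ℝ, ℝ) (𝓡 d) γ t (1 : ℝ)) < 0

/-- A curve without endpoints. -/
def IsInextendible {M : Type*} [TopologicalSpace M] (γ : ℝ → M) : Prop :=
  ∀ p, ¬ Tendsto γ atTop (𝓝 p) ∧ ¬ Tendsto γ atBot (𝓝 p)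

/-- A Cauchy surface: a subset met exactly once by every inextendible timelike curve. -/
def IsCauchySurface (g : LorentzMetric d M) (C : Set M) : Prop :=
  ∀ γ : ℝ → M, IsTimelikeCurve g γ → IsInextendible γ → ∃! t, γ t ∈ C

end Lorentz

variable (n : ℕ) (M : Type u) [TopologicalSpace M]
  [ChartedSpace (EuclideanSpace ℝ (Fin (n + 1))) M] [IsManifold (𝓡 (n + 1)) ∞ M]
  (S : Type v) [TopologicalSpace S]
  [ChartedSpace (EuclideanSpace ℝ (Fin n)) S] [IsManifold (𝓡 n) ∞ S]

/-- The structure of a globally hyperbolic spacetime on the `(n+1)`-dimensional manifold `M`,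
together with a smooth spacelike Cauchy surface given by an embedding of the manifold `S`.
(Global hyperbolicity is the existence of a Cauchy surface.) -/
structure CauchySpacetime where
  /-- the Lorentzian metric -/
  metric : LorentzMetric (n + 1) M
  /-- the time-orientation -/
  time : TimeOrientation metric
  /-- the orientation -/
  orientation : ManifoldOrientation (n + 1) M
  /-- the embedding `S → M` -/
  incl : C(S, M)
  isSmoothEmbedding : Manifold.IsSmoothEmbedding (𝓡 n) (𝓡 (n + 1)) ∞ incl
  spacelike : ∀ (x : S) (v : TangentSpace (𝓡 n) x), v ≠ 0 →
    0 < metric.val (incl x) (mfderiv (𝓡 n) (𝓡 (n + 1)) incl x v)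
      (mfderiv (𝓡 n) (𝓡 (n + 1)) incl x v)
  isCauchySurface : IsCauchySurface metric (Set.range incl)

namespace CauchySpacetime

variable {n M S} (D : CauchySpacetime n M S)

open Classical in
/-- The sign of a basis of a tangent space of `S` for the orientation induced by the orientation and
time-orientation of `M`: `v` is positive if `(T, v₁, …, v_n)` is positively oriented in `M`, for
future-directed timelike `T`. -/
def inducedSign (x : S) (v : Fin n → TangentSpace (𝓡 n) x) : ℤ :=
  if IsPositiveBasis (D.orientation.val (D.incl x))
    (Fin.cons (D.time.val (D.incl x)) fun i => mfderiv (𝓡 n) (𝓡 (n + 1)) D.incl x (v i) :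
      Fin (n + 1) → TangentSpace (𝓡 (n + 1)) (D.incl x))
  then 1 else -1

end CauchySpacetime

/-- Chains in `S` that are supported in the complement of the point `x`. -/
def chainsAvoiding {S : Type v} [TopologicalSpace S] (x : S) (n : ℕ) : AddSubgroup (Chain S n) :=
  AddSubgroup.closure {c | ∃ s : SingularSimplex S n, x ∉ Set.range s ∧ c = Finsupp.single s 1}

namespace CauchySpacetime

variable {n M S} (D : CauchySpacetime n M S)

/-- `c` is the fundamental class of `S` (with the induced orientation): for every point `x`, its
image in the local homology `H_n(S, S ∖ {x}; ℤ)` is the local orientation class. The latter is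
represented by any singular simplex `s` which is affine in the chart at `x`, with vertices
`w₀, …, w_n` and containing `x` in its interior, taken with the sign of the basis
`(w₁ - w₀, …, w_n - w₀)`. -/
def IsFundamentalClass (c : Homology S n) : Prop :=
  ∀ (x : S) (w : Fin (n + 1) → EuclideanSpace ℝ (Fin n)) (s : SingularSimplex S n),
    (∀ t, s t ∈ (chartAt (EuclideanSpace ℝ (Fin n)) x).source ∧
      chartAt (EuclideanSpace ℝ (Fin n)) x (s t) = ∑ i, t i • w i) →
    chartAt (EuclideanSpace ℝ (Fin n)) x x ∈ interior (convexHull ℝ (Set.range w)) →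
    ∃ z : cycles S n, QuotientAddGroup.mk z = c ∧
      (z : Chain S n) - Finsupp.single s (D.inducedSign x fun i =>
        (mfderiv (𝓡 n) 𝓘(ℝ, EuclideanSpace ℝ (Fin n))
          (chartAt (EuclideanSpace ℝ (Fin n)) x) x).inverse (w i.succ - w 0)) ∈
        chainsAvoiding x n ⊔ boundaries S n

open Classical in
/-- The fundamental class `[S] ∈ H_n(S; ℤ)` of the compact Cauchy surface. (It exists and is unique
for compact `S`; the value `0` is never taken then.) -/
def fundamentalClass : Homology S n :=
  if h : ∃ c, D.IsFundamentalClass c then h.choose else 0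

/-- The form `σ_tor` on `Topᵏ_tor(M) = H^{k,l}_tor(M; ℤ)`, `k + l = n + 1 = dim M`. -/
def sigmaTor (k l : ℕ) (h : k + l = n + 1) : PresymplecticForm (TopTor M k l) :=
  (sigmaTorSurface D.fundamentalClass k l h).pullback (TopTor.pullback D.incl k l)

/-- The C*-algebra `𝒲(Topᵏ_tor(M))`. -/
abbrev TorWeylAlgebra (k l : ℕ) (h : k + l = n + 1) : Type u :=
  WeylAlgebra (D.sigmaTor k l h)

/-- `φ` takes the values `φ(W(t, t̃)) = 1` for `(t, t̃) = 0`, and `0` otherwise. -/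
def IsTorFunctional {k l : ℕ} {h : k + l = n + 1} (φ : D.TorWeylAlgebra k l h →L[ℂ] ℂ) : Prop :=
  (φ (weyl _ 0) = 1) ∧ ∀ x : TopTor M k l, x ≠ 0 → φ (weyl _ x) = 0

/-- `Z` extends `W(x) ↦ W(ζ_tor x)`, so that it is the quantum duality `𝒲(ζ_tor)`. -/
def IsTorDuality {k l : ℕ} {h : k + l = n + 1} {h' : l + k = n + 1}
    (Z : D.TorWeylAlgebra k l h →⋆ₐ[ℂ] D.TorWeylAlgebra l k h') : Prop :=
  ∀ x : TopTor M k l, Z (weyl _ x) = weyl _ (zetaTor M k l x)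

end CauchySpacetime

end Spacetime

end AbelianDuality

end

noncomputable section

namespace AbelianDuality

universe u v w

/-! ## The universal property of the Weyl C*-algebra -/

section CompletionLift

variable {A : Type u} [SeminormedRing A] [StarRing A] [NormedAlgebra ℂ A]
  {C : Type v} [CStarAlgebra C]

/-! The functional is the canonical trace of a twisted group algebra. On `ℓ²(G)` the twisted
translations `(W(x)f)(y) = exp(2πi σ(x, y)) f(y - x)` satisfy the Weyl relations as soon as `σ(x, x)
= 0`, so they define a representation `λ` of `𝒲(G)`. The vector state `a ↦ ⟨δ₀, λ(a)δ₀⟩` has the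
prescribed values on the generators. As these span a dense subspace, it is the only bounded
functional with those values.

Faithfulness has two halves. The functional is a trace, so `‖λ(a)δ_x‖ = ‖λ(a)δ₀‖` for all `x`; hence
`δ₀` is separating for `λ(𝒲(G))` (`regularRep_eq_zero`). It remains to see that `λ` is injective,
and here it matters that `G` is a torsion group. An element `a` of `𝒜(G)` is supported in a finite
subgroup `F`, and so are all powers of `a*a`. For elements supported in `F` one has `‖b‖₁ ≤ |F|
‖λ(b)‖`. Applying this to `(a*a)^(2^n)` and letting `n` grow removes the constant, so `λ` is
isometric (`norm_regularRep`).

For the duality, `ζ_tor` has to preserve `σ_tor`, which amounts to the graded symmetry `⟨t, t'⟩ =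
(-1)^{kl} ⟨t', t⟩` of the linking pairing (`torsionPairing_symm`). If real cochains `F`, `F'` lift
`f`, `f'` and have integral coboundaries `z`, `z'`, the coboundary of `F ⌣ F'`, reduced mod `ℤ`,
shows that `z ⌣ f' + (-1)^p f ⌣ z'` is exact, where `p` is the degree of `f`. Graded commutativity
of the cup product then exchanges `z` and `f'`. That commutativity is proved on cochains: reversing
the vertices of a simplex interchanges front and back faces, and the signed reversal is naturally
homotopic to the identity by acyclic models. The universal property of `𝒲(G)` turns `ζ_tor` into a
`*`-homomorphism. Since `ζ_tor` is injective, pulling back the trace gives a functional with the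
same values on generators, so uniqueness yields the invariance. -/

theorem continuous_of_norm_le (f : A →⋆ₐ[ℂ] C) (hf : ∀ a, ‖f a‖ ≤ ‖a‖) :
    Continuous (f : A →+* C) :=
  AddMonoidHomClass.continuous_of_bound f 1 (by simpa using hf)

variable [NormedStarGroup A]

/-- The extension of a contractive `*`-homomorphism to the completion. -/
def completionLift (f : A →⋆ₐ[ℂ] C) (hf : ∀ a, ‖f a‖ ≤ ‖a‖) :
    UniformSpace.Completion A →⋆ₐ[ℂ] C where
  __ := UniformSpace.Completion.extensionHom (f : A →+* C) (continuous_of_norm_le f hf)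
  commutes' c := by
    change UniformSpace.Completion.extensionHom (f : A →+* C) (continuous_of_norm_le f hf)
      (algebraMap ℂ A c : A) = _
    rw [UniformSpace.Completion.extensionHom_coe]
    exact AlgHomClass.commutes f c
  map_star' a := by
    change UniformSpace.Completion.extensionHom (f : A →+* C) (continuous_of_norm_le f hf)
      (star a) = star (UniformSpace.Completion.extensionHom (f : A →+* C)
        (continuous_of_norm_le f hf) a)
    have hc : Continuous (UniformSpace.Completion.extensionHom (f : A →+* C)
        (continuous_of_norm_le f hf)) := UniformSpace.Completion.continuous_extension
    induction a using UniformSpace.Completion.induction_on with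
    | hp => exact isClosed_eq (hc.comp completion_continuous_star) (continuous_star.comp hc)
    | ih a =>
      rw [← completion_coe_star, UniformSpace.Completion.extensionHom_coe,
        UniformSpace.Completion.extensionHom_coe]
      exact map_star f a

theorem completionLift_coe (f : A →⋆ₐ[ℂ] C) (hf : ∀ a, ‖f a‖ ≤ ‖a‖) (a : A) :
    completionLift f hf (a : UniformSpace.Completion A) = f a :=
  UniformSpace.Completion.extensionHom_coe (f : A →+* C) (continuous_of_norm_le f hf) a

theorem continuous_completionLift (f : A →⋆ₐ[ℂ] C) (hf : ∀ a, ‖f a‖ ≤ ‖a‖) :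
    Continuous (completionLift f hf) :=
  UniformSpace.Completion.continuous_extension

theorem norm_completionLift_le (f : A →⋆ₐ[ℂ] C) (hf : ∀ a, ‖f a‖ ≤ ‖a‖)
    (a : UniformSpace.Completion A) : ‖completionLift f hf a‖ ≤ ‖a‖ := by
  induction a using UniformSpace.Completion.induction_on with
  | hp => exact isClosed_le (continuous_norm.comp (continuous_completionLift f hf)) continuous_norm
  | ih a =>
    rw [completionLift_coe, UniformSpace.Completion.norm_coe]
    exact hf a

end CompletionLift

/-! ### Extension of contractive `*`-homomorphisms to the enveloping C*-algebra. -/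

section EnvelopeLift

variable {B : Type u} [NormedRing B] [StarRing B] [NormedAlgebra ℂ B]
  {C : Type v} [CStarAlgebra C]

/-- The C*-seminorm defined by a contractive `*`-homomorphism into a C*-algebra. -/
def CStarSeminorm.ofHom (f : B →⋆ₐ[ℂ] C) (hf : ∀ a, ‖f a‖ ≤ ‖a‖) : CStarSeminorm B where
  __ := (normSeminorm ℂ C).comp (f : B →ₗ[ℂ] C)
  mul_le' a b := by
    change ‖f (a * b)‖ ≤ ‖f a‖ * ‖f b‖
    rw [map_mul]
    exact norm_mul_le _ _
  star_mul_self' a := by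
    change ‖f (star a * a)‖ = ‖f a‖ * ‖f a‖
    rw [map_mul, map_star, CStarRing.norm_star_mul_self]
  le_norm' := hf

/-- The extension of a contractive `*`-homomorphism to the enveloping C*-algebra. -/
def envelopeLift (f : B →⋆ₐ[ℂ] C) (hf : ∀ a, ‖f a‖ ≤ ‖a‖) : EnvelopingCStar B →⋆ₐ[ℂ] C :=
  completionLift (A := EnvelopePre B) f
    -- The map `a ↦ ‖f a‖` is itself a C*-seminorm, hence lies below the largest one; so `f` is
    -- contractive also for the smaller norm of `EnvelopePre B`.
    (fun a => le_maxCStarSeminorm (CStarSeminorm.ofHom f hf) a)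

theorem envelopeLift_toEnvelope (f : B →⋆ₐ[ℂ] C) (hf : ∀ a, ‖f a‖ ≤ ‖a‖) (b : B) :
    envelopeLift f hf (toEnvelope b) = f b :=
  completionLift_coe (A := EnvelopePre B) f _ b

theorem norm_toEnvelope_le (b : B) : ‖toEnvelope b‖ ≤ ‖b‖ := by
  unfold toEnvelope
  rw [UniformSpace.Completion.norm_coe]
  exact maxCStarSeminorm_le fun p => p.le_norm' b

end EnvelopeLift

/-! ### Weyl systems, density of `𝒜(G)` and functoriality of `𝒲(G)`. -/

section Weyl

variable {G : Type u} [AddCommGroup G] {σ : PresymplecticForm G}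

/-- A representation of the Weyl relations in a C*-algebra. -/
structure IsWeylSystem (σ : PresymplecticForm G) {C : Type v} [CStarAlgebra C] (W : G → C) :
    Prop where
  map_zero : W 0 = 1
  map_mul : ∀ x y, W x * W y = σ.phase x y • W (x + y)
  map_star : ∀ x, star (W x) = W (-x)

theorem isWeylSystem_weyl (σ : PresymplecticForm G) : IsWeylSystem σ (weyl σ) :=
  ⟨weyl_zero σ, weyl_mul σ, weyl_star σ⟩

namespace IsWeylSystem

variable {C : Type v} [CStarAlgebra C] {W : G → C}

/-- `(W x)* W x` is a phase times `1`, so the C*-identity gives `‖W x‖² = ‖1‖`, and likewise `‖1‖² =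
‖1‖`. Only an inequality is claimed because `C` may be the zero algebra. -/
theorem norm_le (hW : IsWeylSystem σ W) (x : G) : ‖W x‖ ≤ 1 := by
  have h1 : ‖W x‖ * ‖W x‖ = ‖(1 : C)‖ := by
    rw [← CStarRing.norm_star_mul_self, hW.map_star, hW.map_mul, neg_add_cancel, hW.map_zero,
      norm_smul, σ.norm_phase, one_mul]
  have h2 : ‖(1 : C)‖ * ‖(1 : C)‖ = ‖(1 : C)‖ := by
    rw [← CStarRing.norm_star_mul_self, star_one, one_mul]
  have h3 : ‖(1 : C)‖ ≤ 1 := by nlinarith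
  nlinarith

/-- The linear extension of a Weyl system to `𝒜(G)`. -/
def linear (σ : PresymplecticForm G) (W : G → C) : WeylPre σ →ₗ[ℂ] C :=
  Finsupp.linearCombination ℂ W

theorem linear_single (x : G) (α : ℂ) :
    linear σ W (WeylPre.single x α) = α • W x :=
  Finsupp.linearCombination_single ℂ α x

/-- The `*`-homomorphism on `𝒜(G)` defined by a Weyl system. -/
def preHom (hW : IsWeylSystem σ W) : WeylPre σ →⋆ₐ[ℂ] C where
  __ := AlgHom.ofLinearMap (linear σ W)
    (by rw [WeylPre.one_def, linear_single, hW.map_zero, one_smul])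
    (fun a b => by
      induction a using WeylPre.induction with
      | zero => simp
      | add a a' h h' => rw [add_mul, _root_.map_add, h, h', _root_.map_add, add_mul]
      | single x α =>
        induction b using WeylPre.induction with
        | zero => simp
        | add a a' h h' => rw [mul_add, _root_.map_add, h, h', _root_.map_add, mul_add]
        | single y β =>
          rw [WeylPre.single_mul_single, linear_single, linear_single, linear_single,
            smul_mul_smul_comm, hW.map_mul, smul_smul])
  map_star' a := by
    change linear σ W (star a) = star (linear σ W a)
    induction a using WeylPre.induction with
    | zero => simp
    | add a a' h h' => simp only [star_add, _root_.map_add, h, h']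
    | single x α => rw [WeylPre.star_single, linear_single, linear_single, star_smul, hW.map_star]

theorem preHom_single (hW : IsWeylSystem σ W) (x : G) (α : ℂ) :
    hW.preHom (WeylPre.single x α) = α • W x := linear_single x α

theorem norm_preHom_le (hW : IsWeylSystem σ W) (a : WeylPre σ) : ‖hW.preHom a‖ ≤ ‖a‖ := by
  rw [WeylPre.norm_def, WeylPre.ell1Norm_eq_sum a _ subset_rfl]
  nth_rw 1 [WeylPre.eq_sum_single a]
  rw [map_sum]
  refine (norm_sum_le _ _).trans (Finset.sum_le_sum fun x _ => ?_)
  rw [preHom_single, norm_smul]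
  exact mul_le_of_le_one_right (norm_nonneg _) (hW.norm_le x)

/-- The `*`-homomorphism on `𝒲(G)` defined by a Weyl system. -/
def lift (hW : IsWeylSystem σ W) : WeylAlgebra σ →⋆ₐ[ℂ] C :=
  envelopeLift (completionLift hW.preHom hW.norm_preHom_le) (norm_completionLift_le _ _)

theorem lift_weyl (hW : IsWeylSystem σ W) (x : G) : hW.lift (weyl σ x) = W x := by
  unfold lift weyl
  rw [envelopeLift_toEnvelope, completionLift_coe, preHom_single, one_smul]

end IsWeylSystem

/-- The canonical `*`-homomorphism `𝒜(G) → 𝒲(G)`. -/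
def ofPre (σ : PresymplecticForm G) : WeylPre σ →⋆ₐ[ℂ] WeylAlgebra σ :=
  (isWeylSystem_weyl σ).preHom

theorem ofPre_single (x : G) (α : ℂ) : ofPre σ (WeylPre.single x α) = α • weyl σ x :=
  (isWeylSystem_weyl σ).preHom_single x α

theorem toEnvelope_coe (a : WeylPre σ) : toEnvelope (a : WeylBanach σ) = ofPre σ a := by
  have hadd : ∀ b c : WeylBanach σ, toEnvelope (b + c) = toEnvelope b + toEnvelope c :=
    fun b c => UniformSpace.Completion.coe_add (α := EnvelopePre (WeylBanach σ)) b c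
  have hsmul : ∀ (α : ℂ) (b : WeylBanach σ), toEnvelope (α • b) = α • toEnvelope b :=
    fun α b => (UniformSpace.Completion.toComplₗᵢ (𝕜 := ℂ)
      (E := EnvelopePre (WeylBanach σ))).map_smul α b
  induction a using WeylPre.induction with
  | zero =>
    rw [UniformSpace.Completion.coe_zero, map_zero]
    exact UniformSpace.Completion.coe_zero (α := EnvelopePre (WeylBanach σ))
  | add a b ha hb => rw [UniformSpace.Completion.coe_add, hadd, ha, hb, map_add]
  | single x α =>
    rw [ofPre_single, weyl, ← hsmul, ← UniformSpace.Completion.coe_smul, WeylPre.smul_single,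
      mul_one]

/-- Two completions are composed: `𝒜(G)` is dense in `ℬ(G)`, which has dense image in `𝒲(G)`. The
densities combine because `toEnvelope` is additive and contractive, hence continuous from the Banach
norm to the C*-norm. -/
theorem denseRange_ofPre (σ : PresymplecticForm G) : DenseRange (ofPre σ) := by
  have h1 : DenseRange (toEnvelope (B := WeylBanach σ)) :=
    UniformSpace.Completion.denseRange_coe (α := EnvelopePre (WeylBanach σ))
  have h2 : DenseRange ((↑) : WeylPre σ → WeylBanach σ) := UniformSpace.Completion.denseRange_coe
  have h3 : Continuous (toEnvelope (B := WeylBanach σ)) := by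
    refine continuous_iff_continuousAt.mpr fun b => ?_
    rw [ContinuousAt, tendsto_iff_norm_sub_tendsto_zero]
    have hb : Filter.Tendsto (fun c => ‖c - b‖) (nhds b) (nhds 0) :=
      tendsto_iff_norm_sub_tendsto_zero.mp Filter.tendsto_id
    refine squeeze_zero (fun _ => norm_nonneg _) (fun c => ?_) hb
    have : toEnvelope c - toEnvelope b = toEnvelope (c - b) :=
      (UniformSpace.Completion.coe_sub (α := EnvelopePre (WeylBanach σ)) c b).symm
    rw [this]
    exact norm_toEnvelope_le _
  have := h1.comp h2 h3
  convert this using 1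
  funext a
  exact (toEnvelope_coe a).symm

/-- Two continuous additive maps on `𝒲(G)` agree if they agree on the image of `𝒜(G)`. -/
theorem eq_of_eq_ofPre {E : Type*} [TopologicalSpace E] [T2Space E] {f g : WeylAlgebra σ → E}
    (hf : Continuous f) (hg : Continuous g) (h : ∀ a : WeylPre σ, f (ofPre σ a) = g (ofPre σ a)) :
    f = g :=
  (denseRange_ofPre σ).equalizer hf hg (funext h)

theorem ext_linear {E : Type*} [TopologicalSpace E] [T2Space E] [AddCommGroup E] [Module ℂ E]
    {f g : WeylAlgebra σ →L[ℂ] E} (h : ∀ x, f (weyl σ x) = g (weyl σ x)) : f = g := by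
  refine DFunLike.coe_injective (eq_of_eq_ofPre f.continuous g.continuous fun a => ?_)
  induction a using WeylPre.induction with
  | zero => simp
  | add a b ha hb => simp only [map_add, ha, hb]
  | single x α => simp only [ofPre_single, map_smul, h]

theorem continuous_starHom {A : Type u} {C : Type v} [CStarAlgebra A] [CStarAlgebra C]
    (f : A →⋆ₐ[ℂ] C) : Continuous f :=
  AddMonoidHomClass.continuous_of_bound f 1 (by simpa using NonUnitalStarAlgHom.norm_apply_le f)

/-- Continuity need not be assumed: `*`-homomorphisms between C*-algebras are contractive, so the
generators determine them by density. -/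
theorem ext_starHom {C : Type v} [CStarAlgebra C] {f g : WeylAlgebra σ →⋆ₐ[ℂ] C}
    (h : ∀ x, f (weyl σ x) = g (weyl σ x)) : f = g := by
  refine DFunLike.coe_injective (eq_of_eq_ofPre (continuous_starHom f) (continuous_starHom g)
    fun a => ?_)
  induction a using WeylPre.induction with
  | zero => simp
  | add a b ha hb => simp only [map_add, ha, hb]
  | single x α => simp only [ofPre_single, map_smul, h]

/-- Functoriality: a homomorphism preserving the forms induces a unique `*`-homomorphism. -/
theorem existsUnique_weylMap {H : Type v} [AddCommGroup H] {τ : PresymplecticForm H} (ζ : G →+ H)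
    (hζ : ∀ x y, τ.toHom (ζ x) (ζ y) = σ.toHom x y) :
    ∃! Z : WeylAlgebra σ →⋆ₐ[ℂ] WeylAlgebra τ, ∀ x, Z (weyl σ x) = weyl τ (ζ x) := by
  have hW : IsWeylSystem σ fun x => weyl τ (ζ x) :=
    ⟨by rw [map_zero, weyl_zero],
      fun x y => by
        rw [weyl_mul, map_add, PresymplecticForm.phase, PresymplecticForm.phase, hζ],
      fun x => by rw [weyl_star, map_neg]⟩
  exact ⟨hW.lift, hW.lift_weyl, fun Z hZ => ext_starHom fun x => by rw [hZ, hW.lift_weyl]⟩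

end Weyl

/-! ## The regular representation and the canonical trace -/

section Regular

open scoped InnerProductSpace

/-- The Hilbert space `ℓ²(G)`. -/
abbrev EllTwo (G : Type u) : Type u := lp (fun _ : G => ℂ) 2

section Delta

variable {G : Type u}

open Classical in
/-- The basis vector `δ_x` of `ℓ²(G)`. -/
def delta (x : G) : EllTwo G := lp.single 2 x (1 : ℂ)

open Classical in
theorem delta_apply (x y : G) : delta x y = if y = x then 1 else 0 := by
  simp [delta, lp.single_apply, Pi.single_apply]

theorem norm_delta (x : G) : ‖delta x‖ = 1 := by
  simp [delta, lp.norm_single]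

theorem inner_delta_left (x : G) (f : EllTwo G) : ⟪delta x, f⟫_ℂ = f x := by
  simp [delta, lp.inner_single_left]

end Delta

variable {G : Type u} [AddCommGroup G] (σ : PresymplecticForm G)

theorem summable_norm_sq_twist (x : G) (f : EllTwo G) :
    Summable fun y => ‖σ.phase x y * f (y - x)‖ ^ 2 := by
  have h := (lp.memℓp f).summable (by norm_num)
  have h2 := (Equiv.subRight x).summable_iff.mpr h
  simpa [Function.comp_def] using h2

/-- The operator `W(x)` on `ℓ²(G)`, `(W(x) f)(y) = exp(2πi σ(x, y)) f(y - x)`. -/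
def regularLinear (x : G) : EllTwo G →ₗ[ℂ] EllTwo G where
  toFun f := ⟨fun y => σ.phase x y * f (y - x),
    memℓp_gen (by simpa using summable_norm_sq_twist σ x f)⟩
  map_add' f g := by
    ext y
    exact mul_add _ _ _
  map_smul' c f := by
    ext y
    simp [mul_left_comm]

theorem regularLinear_apply (x : G) (f : EllTwo G) (y : G) :
    regularLinear σ x f y = σ.phase x y * f (y - x) := rfl

theorem norm_regularLinear (x : G) (f : EllTwo G) : ‖regularLinear σ x f‖ = ‖f‖ := by
  rw [lp.norm_eq_tsum_rpow (by norm_num), lp.norm_eq_tsum_rpow (by norm_num)]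
  congr 1
  rw [← (Equiv.subRight x).tsum_eq fun y => ‖f y‖ ^ (2 : ENNReal).toReal]
  refine tsum_congr fun y => ?_
  simp [regularLinear_apply]

/-- The operator `W(x)` on `ℓ²(G)` as a bounded operator. -/
def regular (x : G) : EllTwo G →L[ℂ] EllTwo G :=
  (regularLinear σ x).mkContinuous 1 fun f => by rw [norm_regularLinear, one_mul]

theorem regular_apply (x : G) (f : EllTwo G) (y : G) :
    regular σ x f y = σ.phase x y * f (y - x) := rfl

variable {σ}

/-- Antisymmetry alone gives `2σ(x, x) = 0`, that is, a phase `±1`. The regular representation in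
the present form needs the phase to be `1`, whence the hypothesis `hσ`. -/
theorem PresymplecticForm.phase_self (hσ : ∀ x, σ.toHom x x = 0) (x : G) : σ.phase x x = 1 := by
  simp [PresymplecticForm.phase, hσ]

theorem PresymplecticForm.phase_neg_right (x y : G) : σ.phase x (-y) = σ.phase y x := by
  rw [PresymplecticForm.phase, PresymplecticForm.phase, map_neg, ← σ.antisymm]

/-- Translating the argument of `W(y)f` by `x` contributes the phase of `σ(y, -x) = σ(x, y)`, which
is the Weyl cocycle. For the adjoint, the summation variable is shifted by `x`; this leaves a factor
`exp(2πi σ(x, x))`, which `hσ` removes. -/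
theorem isWeylSystem_regular (hσ : ∀ x, σ.toHom x x = 0) : IsWeylSystem σ (regular σ) where
  map_zero := by
    ext f y
    simp [regular_apply]
  map_mul x y := by
    ext f z
    change σ.phase x z * (σ.phase y (z - x) * f (z - x - y)) =
      σ.phase x y * (σ.phase (x + y) z * f (z - (x + y)))
    have h : σ.phase y (z - x) = σ.phase x y * σ.phase y z := by
      rw [sub_eq_add_neg, σ.phase_add_right, σ.phase_neg_right, mul_comm]
    rw [h, σ.phase_add_left, sub_sub]
    ring
  map_star x := by
    rw [ContinuousLinearMap.star_eq_adjoint, eq_comm, ContinuousLinearMap.eq_adjoint_iff]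
    intro f g
    rw [lp.inner_eq_tsum, lp.inner_eq_tsum, ← (Equiv.subRight x).tsum_eq]
    refine tsum_congr fun y => ?_
    have h : star (σ.phase (-x) (y - x)) = σ.phase x y := by
      rw [σ.star_phase, sub_eq_add_neg, σ.phase_add_left, σ.phase_neg_neg, σ.phase_self hσ, mul_one,
        σ.phase_neg_right]
    simp only [Equiv.subRight_apply, regular_apply, RCLike.inner_apply, map_mul, sub_neg_eq_add,
      sub_add_cancel]
    rw [← h]
    simp only [RCLike.star_def]
    ring

/-- The regular representation of `𝒲(G)` on `ℓ²(G)`. -/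
def regularRep (hσ : ∀ x, σ.toHom x x = 0) : WeylAlgebra σ →⋆ₐ[ℂ] (EllTwo G →L[ℂ] EllTwo G) :=
  (isWeylSystem_regular hσ).lift

variable (hσ : ∀ x, σ.toHom x x = 0)

theorem regularRep_weyl (x : G) : regularRep hσ (weyl σ x) = regular σ x :=
  (isWeylSystem_regular hσ).lift_weyl x

theorem norm_regularRep_le (a : WeylAlgebra σ) : ‖regularRep hσ a‖ ≤ ‖a‖ :=
  NonUnitalStarAlgHom.norm_apply_le (regularRep hσ) a

theorem continuous_regularRep : Continuous (regularRep hσ) :=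
  continuous_starHom _

theorem regular_delta_zero (hσ : ∀ x, σ.toHom x x = 0) (x : G) :
    regular σ x (delta 0) = delta x := by
  ext y
  rw [regular_apply, delta_apply, delta_apply, sub_eq_zero]
  split_ifs with h
  · rw [h, σ.phase_self hσ, mul_one]
  · rw [mul_zero]

theorem regularRep_weyl_delta_zero (x : G) : regularRep hσ (weyl σ x) (delta 0) = delta x := by
  rw [regularRep_weyl, regular_delta_zero hσ]

/-! ### The trace and its separating vector. -/

/-- The canonical trace `a ↦ ⟨δ₀, a δ₀⟩` on `𝒲(G)`. -/
def weylTrace : WeylAlgebra σ →L[ℂ] ℂ :=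
  LinearMap.mkContinuous
    { toFun := fun a => ⟪delta 0, regularRep hσ a (delta 0)⟫_ℂ
      map_add' := fun a b => by
        rw [map_add, add_apply, inner_add_right]
      map_smul' := fun c a => by
        rw [map_smul, smul_apply, inner_smul_right]
        rfl }
    1 (fun a => by
      refine (norm_inner_le_norm (𝕜 := ℂ) (delta 0) (regularRep hσ a (delta 0))).trans ?_
      rw [norm_delta, one_mul, one_mul]
      refine ((regularRep hσ a).le_opNorm _).trans ?_
      rw [norm_delta, mul_one]
      exact norm_regularRep_le hσ a)

theorem weylTrace_apply (a : WeylAlgebra σ) :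
    weylTrace hσ a = ⟪delta 0, regularRep hσ a (delta 0)⟫_ℂ := rfl

theorem weylTrace_star_mul_self (a : WeylAlgebra σ) :
    weylTrace hσ (star a * a) = (‖regularRep hσ a (delta 0)‖ : ℂ) ^ 2 := by
  rw [weylTrace_apply, map_mul, map_star, ContinuousLinearMap.star_eq_adjoint,
    mul_apply_eq_comp, ContinuousLinearMap.adjoint_inner_right,
    inner_self_eq_norm_sq_to_K]
  rfl

open Classical in
theorem weylTrace_weyl (x : G) : weylTrace hσ (weyl σ x) = if x = 0 then 1 else 0 := by
  rw [weylTrace_apply, regularRep_weyl_delta_zero, inner_delta_left, delta_apply]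
  simp only [eq_comm]

theorem isState_weylTrace : IsState (weylTrace hσ) := by
  refine ⟨by rw [← weyl_zero σ, weylTrace_weyl, if_pos rfl], fun a => ?_⟩
  rw [weylTrace_star_mul_self]
  exact_mod_cast sq_nonneg ‖regularRep hσ a (delta 0)‖

/-- The canonical trace is the only functional with its values on the generators. -/
theorem eq_weylTrace {φ : WeylAlgebra σ →L[ℂ] ℂ} (h0 : φ (weyl σ 0) = 1)
    (h : ∀ x, x ≠ 0 → φ (weyl σ x) = 0) : φ = weylTrace hσ := by
  refine ext_linear fun x => ?_
  rw [weylTrace_weyl]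
  split_ifs with hx
  · rw [hx, h0]
  · exact h x hx

/-- By linearity and density it suffices to test `a = W(y)`. Both sides vanish unless `y = -x`, and
then both phases equal `exp(2πi σ(x, x))` by antisymmetry. -/
theorem weylTrace_mul_weyl (a : WeylAlgebra σ) (x : G) :
    weylTrace hσ (a * weyl σ x) = weylTrace hσ (weyl σ x * a) := by
  have : (weylTrace hσ).comp ((ContinuousLinearMap.mul ℂ (WeylAlgebra σ)).flip (weyl σ x)) =
      (weylTrace hσ).comp (ContinuousLinearMap.mul ℂ (WeylAlgebra σ) (weyl σ x)) := by
    refine ext_linear fun y => ?_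
    simp only [ContinuousLinearMap.comp_apply, ContinuousLinearMap.flip_apply,
      ContinuousLinearMap.mul_apply', weyl_mul, map_smul, weylTrace_weyl]
    rw [add_comm x y]
    split_ifs with h
    · rw [eq_neg_of_add_eq_zero_left h, σ.phase_neg_right, ← σ.phase_neg_right, neg_neg]
    · simp
  exact DFunLike.congr_fun this a

theorem weyl_mul_star (hσ : ∀ x, σ.toHom x x = 0) (x : G) : weyl σ x * star (weyl σ x) = 1 := by
  rw [weyl_star, weyl_mul, add_neg_cancel, σ.phase_neg_right, σ.phase_self hσ, one_smul, weyl_zero]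

/-- The vector `δ₀` is separating for the regular representation. -/
theorem regularRep_eq_zero {a : WeylAlgebra σ} (ha : regularRep hσ a (delta 0) = 0) :
    regularRep hσ a = 0 := by
  classical
  have h : ∀ x, regularRep hσ a (delta x) = 0 := by
    intro x
    -- The left side is `‖λ(a)δ_x‖²` and the right side `‖λ(a)δ₀‖²`, as `W(x)` sends `δ₀` to `δ_x`.
    -- They agree because the outer `W(x)` can be moved around the trace and `W(x)` is unitary.
    have h1 : weylTrace hσ (star (a * weyl σ x) * (a * weyl σ x)) = weylTrace hσ (star a * a) := by
      rw [star_mul, ← mul_assoc, weylTrace_mul_weyl, mul_assoc, ← mul_assoc, ← mul_assoc,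
        weyl_mul_star hσ, one_mul]
    rw [weylTrace_star_mul_self, weylTrace_star_mul_self, ha, norm_zero, map_mul,
      mul_apply_eq_comp, regularRep_weyl_delta_zero] at h1
    simpa using h1
  ext1 f
  have h2 := (lp.hasSum_single (E := fun _ : G => ℂ) (p := 2) (by norm_num) f).mapL
    (regularRep hσ a)
  have h3 : ∀ x, regularRep hσ a (lp.single 2 x (f x)) = 0 := by
    intro x
    have : (lp.single 2 x (f x) : EllTwo G) = f x • delta x := by
      rw [delta, ← lp.single_smul, smul_eq_mul, mul_one]
    rw [this, map_smul, h, smul_zero]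
  simp only [h3] at h2
  exact h2.unique hasSum_zero

/-! ### The regular representation is isometric when `G` is a torsion group. -/

theorem regularRep_ofPre_delta_zero (a : WeylPre σ) (x : G) :
    regularRep hσ (ofPre σ a) (delta 0) x = a.coeff x := by
  classical
  induction a using WeylPre.induction with
  | zero => simp; rfl
  | add a b ha hb =>
    rw [map_add, map_add, add_apply, lp.coeFn_add, Pi.add_apply, ha, hb]
    rfl
  | single y α =>
    rw [ofPre_single, map_smul, smul_apply, regularRep_weyl_delta_zero, lp.coeFn_smul,
      Pi.smul_apply, delta_apply, smul_eq_mul, mul_ite, mul_one, mul_zero]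
    exact ((Finsupp.single_apply (a := y) (b := α) (a' := x)).trans (by simp only [eq_comm])).symm

/-- The coefficients of `a` are the entries of the vector `λ(a)δ₀`, and `δ₀` is a unit vector. -/
theorem norm_coeff_le (a : WeylPre σ) (x : G) : ‖a.coeff x‖ ≤ ‖regularRep hσ (ofPre σ a)‖ := by
  rw [← regularRep_ofPre_delta_zero hσ]
  refine (lp.norm_apply_le_norm (by norm_num) _ x).trans ?_
  simpa [norm_delta] using (regularRep hσ (ofPre σ a)).le_opNorm (delta 0)

/-- The elements of `𝒜(G)` supported in a subgroup form a submonoid. -/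
def supportedIn (σ : PresymplecticForm G) (F : AddSubgroup G) : Submonoid (WeylPre σ) where
  carrier := {a | ∀ x, x ∉ F → a.coeff x = 0}
  one_mem' x hx := Finsupp.single_eq_of_ne (by rintro rfl; exact hx F.zero_mem)
  mul_mem' {a b} ha hb x hx := by
    have hsum : ∀ {ι : Type u} (s : Finset ι) (f : ι → WeylPre σ),
        (∀ i ∈ s, (f i).coeff x = 0) → (∑ i ∈ s, f i).coeff x = 0 := fun s f h =>
      (Finsupp.finsetSum_apply s (fun i => (f i).coeff) x).trans (Finset.sum_eq_zero h)
    rw [a.eq_sum_single, b.eq_sum_single, Finset.sum_mul_sum]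
    refine hsum _ _ fun y hy => hsum _ _ fun z hz => ?_
    rw [WeylPre.single_mul_single]
    refine Finsupp.single_eq_of_ne ?_
    rintro rfl
    refine hx (F.add_mem ?_ ?_)
    · by_contra h
      exact Finsupp.mem_support_iff.mp hy (ha y h)
    · by_contra h
      exact Finsupp.mem_support_iff.mp hz (hb z h)

theorem star_mem_supportedIn {F : AddSubgroup G} {a : WeylPre σ} (ha : a ∈ supportedIn σ F) :
    star a ∈ supportedIn σ F := by
  intro x hx
  rw [a.eq_sum_single, star_sum]
  refine (Finsupp.finsetSum_apply _ (fun i => (star (WeylPre.single i (a.coeff i) :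
    WeylPre σ)).coeff) x).trans (Finset.sum_eq_zero fun y hy => ?_)
  rw [WeylPre.star_single]
  refine Finsupp.single_eq_of_ne ?_
  rintro rfl
  exact Finsupp.mem_support_iff.mp hy (ha y fun h => hx (F.neg_mem h))

/-- At most `|F|` coefficients are nonzero, each bounded by the operator norm. The constant is
crude, but it depends on `F` only and so stays the same for all powers of `a`. -/
theorem norm_le_card_mul {F : AddSubgroup G} [Finite F] {a : WeylPre σ}
    (ha : a ∈ supportedIn σ F) : ‖a‖ ≤ Nat.card F * ‖regularRep hσ (ofPre σ a)‖ := by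
  have hF : (F : Set G).Finite := Set.toFinite _
  rw [WeylPre.norm_def, WeylPre.ell1Norm_eq_sum a hF.toFinset fun x hx => by
    by_contra h
    exact Finsupp.mem_support_iff.mp hx (ha x (by simpa using h))]
  refine (Finset.sum_le_card_nsmul _ _ _ fun x _ => norm_coeff_le hσ a x).trans ?_
  rw [nsmul_eq_mul, ← Set.ncard_eq_toFinset_card _ hF]
  rfl

/-- The support generates a finitely generated torsion abelian group, which is finite. -/
theorem exists_mem_supportedIn (hG : IsAddTorsion G) (a : WeylPre σ) :
    ∃ F : AddSubgroup G, Finite F ∧ a ∈ supportedIn σ F := by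
  refine ⟨AddSubgroup.closure a.coeff.support, ?_, fun x hx => ?_⟩
  · refine AddCommGroup.finite_of_fg_isAddTorsion _ ?_
    exact hG.addSubgroup _
  · by_contra h
    exact hx (AddSubgroup.subset_closure (Finsupp.mem_support_iff.mpr h))

/-- If `r > s > 0`, the powers of `r / s` exceed any constant. The exponents `2 ^ n` are those for
which the C*-identity computes the norm of a power of a self-adjoint element. -/
theorem le_of_forall_pow_le_mul {r s C : ℝ} (hs : 0 ≤ s)
    (h : ∀ n : ℕ, r ^ 2 ^ n ≤ C * s ^ 2 ^ n) : r ≤ s := by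
  by_contra! hlt
  rcases hs.eq_or_lt with rfl | hs
  · have := h 0
    simp only [pow_zero, pow_one, mul_zero] at this
    exact absurd this (not_le.mpr hlt)
  have h1 : 1 < r / s := (one_lt_div hs).mpr hlt
  obtain ⟨N, hN⟩ := pow_unbounded_of_one_lt C h1
  have h2 : (r / s) ^ 2 ^ N ≤ C := by
    rw [div_pow, div_le_iff₀ (by positivity)]
    exact h N
  exact absurd (hN.trans_le (pow_le_pow_right₀ h1.le Nat.lt_two_pow_self.le)) (not_lt.mpr h2)

/-- For `b = a*a` and `N = 2 ^ n`, `‖b‖^N = ‖b^N‖ ≤ ‖b^N‖₁ ≤ |F| ‖λ(b^N)‖ = |F| ‖λ(b)‖^N`, because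
`b` is self-adjoint and `b^N` is again supported in `F`. Hence `‖b‖ ≤ ‖λ(b)‖`, and the C*-identity
returns to `a`. -/
theorem norm_le_norm_regularRep_ofPre (hG : IsAddTorsion G) (a : WeylPre σ) :
    ‖ofPre σ a‖ ≤ ‖regularRep hσ (ofPre σ a)‖ := by
  obtain ⟨F, hF, ha⟩ := exists_mem_supportedIn hG a
  have hsa : IsSelfAdjoint (star (ofPre σ a) * ofPre σ a) := IsSelfAdjoint.star_mul_self _
  have key : ‖ofPre σ a‖ * ‖ofPre σ a‖ ≤
      ‖regularRep hσ (ofPre σ a)‖ * ‖regularRep hσ (ofPre σ a)‖ := by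
    refine le_of_forall_pow_le_mul (C := Nat.card F) (by positivity) fun n => ?_
    rw [← CStarRing.norm_star_mul_self, ← CStarRing.norm_star_mul_self, ← hsa.norm_pow_two_pow,
      ← map_star (regularRep hσ), ← map_mul (regularRep hσ),
      ← (hsa.map (regularRep hσ)).norm_pow_two_pow, ← map_pow (regularRep hσ),
      ← map_star (ofPre σ), ← map_mul (ofPre σ), ← map_pow (ofPre σ)]
    exact ((isWeylSystem_weyl σ).norm_preHom_le _).trans (norm_le_card_mul hσ
      (pow_mem (mul_mem (star_mem_supportedIn ha) ha) _))
  exact (mul_self_le_mul_self_iff (norm_nonneg _) (norm_nonneg _)).mpr key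

theorem norm_regularRep (hG : IsAddTorsion G) (a : WeylAlgebra σ) :
    ‖regularRep hσ a‖ = ‖a‖ :=
  congrFun (eq_of_eq_ofPre (continuous_norm.comp (continuous_regularRep hσ)) continuous_norm
    fun a => (norm_regularRep_le hσ _).antisymm (norm_le_norm_regularRep_ofPre hσ hG a)) a

/-- For a torsion group, the canonical trace is faithful. -/
theorem isFaithful_weylTrace (hG : IsAddTorsion G) : IsFaithful (weylTrace hσ) := by
  intro a ha
  rw [weylTrace_star_mul_self] at ha
  have h : regularRep hσ a (delta 0) = 0 := by simpa using ha
  rw [← norm_eq_zero, ← norm_regularRep hσ hG, regularRep_eq_zero hσ h, norm_zero]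

end Regular

open SingularSimplex

/-! ## Graded commutativity of the cup product -/

section VertexChains

variable {V : Type u} {W : Type v}

/-- Integral chains of the ordered simplices with vertices in `V`. -/
abbrev VertexChain (V : Type u) (m : ℕ) : Type u := (Fin (m + 1) → V) →₀ ℤ

namespace VertexChain

/-- The boundary operator. -/
def boundary (m : ℕ) : VertexChain V (m + 1) →+ VertexChain V m :=
  Finsupp.liftAddHom fun g => zmultiplesHom _
    (∑ i : Fin (m + 2), (-1 : ℤ) ^ (i : ℕ) • Finsupp.single (g ∘ i.succAbove) 1)

theorem boundary_single (m : ℕ) (g : Fin (m + 2) → V) :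
    boundary m (Finsupp.single g 1) =
      ∑ i : Fin (m + 2), (-1 : ℤ) ^ (i : ℕ) • Finsupp.single (g ∘ i.succAbove) 1 := by
  simp [boundary]

/-- The chain map given by a map of vertices. -/
def map (φ : V → W) (m : ℕ) : VertexChain V m →+ VertexChain W m :=
  Finsupp.mapDomain.addMonoidHom fun g => φ ∘ g

theorem map_single (φ : V → W) (m : ℕ) (g : Fin (m + 1) → V) :
    map φ m (Finsupp.single g 1) = Finsupp.single (φ ∘ g) 1 := by
  simp [map]

/-- The cone with apex `v`. -/
def cone (v : V) (m : ℕ) : VertexChain V m →+ VertexChain V (m + 1) :=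
  Finsupp.mapDomain.addMonoidHom fun g => Fin.cons v g

theorem cone_single (v : V) (m : ℕ) (g : Fin (m + 1) → V) :
    cone v m (Finsupp.single g 1) = Finsupp.single (Fin.cons v g) 1 := by
  simp [cone]

theorem hom_ext {A : Type w} [AddCommGroup A] {m : ℕ} {f g : VertexChain V m →+ A}
    (h : ∀ x, f (Finsupp.single x 1) = g (Finsupp.single x 1)) : f = g :=
  Finsupp.addHom_ext' fun x => AddMonoidHom.ext_int (h x)

theorem boundary_map (φ : V → W) (m : ℕ) (c : VertexChain V (m + 1)) :
    boundary m (map φ (m + 1) c) = map φ m (boundary m c) := by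
  refine DFunLike.congr_fun (f := (boundary m).comp (map φ (m + 1)))
    (g := (map φ m).comp (boundary m)) (hom_ext fun g => ?_) c
  simp only [AddMonoidHom.comp_apply, map_single, boundary_single, map_sum, map_zsmul,
    Function.comp_assoc]

/-- Deleting the apex returns `c`; deleting any other vertex gives the cone over a face, with index
shifted by one and so with opposite sign. In degree zero an augmentation term would appear, hence
the degree `m + 1`. -/
theorem boundary_cone (v : V) (m : ℕ) (c : VertexChain V (m + 1)) :
    boundary (m + 1) (cone v (m + 1) c) = c - cone v m (boundary m c) := by
  refine DFunLike.congr_fun (f := (boundary (m + 1)).comp (cone v (m + 1)))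
    (g := AddMonoidHom.id _ - (cone v m).comp (boundary m)) (hom_ext fun g => ?_) c
  have h : ∀ i : Fin (m + 2), (Fin.cons v g : Fin (m + 3) → V) ∘ i.succ.succAbove =
      Fin.cons v (g ∘ i.succAbove) := by
    intro i
    funext k
    refine Fin.cases ?_ (fun k => ?_) k <;> simp
  have h0 : (Fin.cons v g : Fin (m + 3) → V) ∘ (0 : Fin (m + 3)).succAbove = g := by
    funext k
    simp
  change boundary (m + 1) (cone v (m + 1) (Finsupp.single g 1)) =
    Finsupp.single g 1 - cone v m (boundary m (Finsupp.single g 1))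
  simp only [cone_single, boundary_single, Fin.sum_univ_succ (n := m + 2), h, h0, map_sum, map_zsmul, Fin.val_succ,
    pow_succ, mul_neg, mul_one, neg_smul, Finset.sum_neg_distrib, Fin.val_zero, pow_zero, one_smul,
    sub_eq_add_neg]

/-- The alternating sum of the maps induced by the faces of the standard `(n + 1)`-simplex. -/
def coface (n m : ℕ) : VertexChain (Fin (n + 1)) m →+ VertexChain (Fin (n + 2)) m :=
  ∑ i : Fin (n + 2), (-1 : ℤ) ^ (i : ℕ) • map i.succAbove m

theorem coface_apply (n m : ℕ) (c : VertexChain (Fin (n + 1)) m) :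
    coface n m c = ∑ i : Fin (n + 2), (-1 : ℤ) ^ (i : ℕ) • map i.succAbove m c := by
  simp [coface]

theorem boundary_coface (n m : ℕ) (c : VertexChain (Fin (n + 1)) (m + 1)) :
    boundary m (coface n (m + 1) c) = coface n m (boundary m c) := by
  simp only [coface_apply, map_sum, map_zsmul, boundary_map]

/-- The cosimplicial identity `hswap` matches the index pairs in `S` with those outside `S`, and
matched terms have opposite signs. -/
theorem coface_coface (n m : ℕ) (c : VertexChain (Fin (n + 1)) m) :
    coface (n + 1) m (coface n m c) = 0 := by
  have hswap : ∀ (i : Fin (n + 2)) (j : Fin (n + 3)) (h : (j : ℕ) ≤ i),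
      j.succAbove ∘ i.succAbove = i.succ.succAbove ∘ (j.castLT (by omega)).succAbove := by
    intro i j h
    funext k
    ext
    simp [Function.comp, val_succAbove]
    all_goals (try split_ifs) <;> omega
  have hmap : ∀ (j : Fin (n + 3)) (i : Fin (n + 2)),
      map j.succAbove m (map i.succAbove m c) = map (j.succAbove ∘ i.succAbove) m c := by
    intro j i
    refine DFunLike.congr_fun (f := (map j.succAbove m).comp (map i.succAbove m))
      (g := map (j.succAbove ∘ i.succAbove) m) (hom_ext fun g => ?_) c
    simp [map_single, Function.comp_assoc]
  simp only [coface_apply, map_sum, map_zsmul, Finset.smul_sum, hmap, smul_smul]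
  rw [Finset.sum_comm, ← Finset.sum_product', Finset.univ_product_univ]
  let S : Finset (Fin (n + 3) × Fin (n + 2)) := {ij | (ij.1 : ℕ) ≤ (ij.2 : ℕ)}
  rw [← Finset.sum_add_sum_compl S, ← eq_neg_iff_add_eq_zero, ← Finset.sum_neg_distrib]
  refine Finset.sum_bij' (fun ij hij => (ij.2.succ, ij.1.castLT
      (lt_of_le_of_lt (Finset.mem_filter.mp hij).2 ij.2.is_lt)))
    (fun ij hij => (ij.2.castSucc, ij.1.pred (by
      rintro h0
      simp [S, h0] at hij))) ?_ ?_ ?_ ?_ ?_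
  · intro ij hij
    have h1 : (ij.1 : ℕ) ≤ ij.2 := (Finset.mem_filter.mp hij).2
    refine Finset.mem_compl.mpr fun h => ?_
    have h2 : (ij.2 : ℕ) + 1 ≤ ij.1 := (Finset.mem_filter.mp h).2
    omega
  · intro ij hij
    have h1 : ¬ (ij.1 : ℕ) ≤ ij.2 := fun h =>
      Finset.mem_compl.mp hij (Finset.mem_filter.mpr ⟨Finset.mem_univ _, h⟩)
    refine Finset.mem_filter.mpr ⟨Finset.mem_univ _, ?_⟩
    simp only [Fin.val_castSucc, Fin.val_pred]
    omega
  · intro ij hij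
    simp
  · intro ij hij
    simp
  · rintro ⟨i, j⟩ hij
    have h : (i : ℕ) ≤ j := by simpa [S] using hij
    simp only [← neg_smul]
    rw [hswap j i h]
    congr 1
    simp only [Fin.val_succ, Fin.val_castLT, pow_succ]
    ring

end VertexChain

/-- The sign `(-1)^{n(n+1)/2}` of the reversal of the vertices of an `n`-simplex. -/
def revSign : ℕ → ℤ
  | 0 => 1
  | n + 1 => (-1) ^ (n + 1) * revSign n

theorem revSign_succ (n : ℕ) : revSign (n + 1) = (-1) ^ (n + 1) * revSign n := rfl

/-- This is the source of the sign `(-1)^{pq}` in graded commutativity. -/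
theorem revSign_add (p q : ℕ) : revSign (p + q) = (-1) ^ (p * q) * (revSign p * revSign q) := by
  induction q with
  | zero => simp [revSign]
  | succ q ih =>
    rw [← add_assoc, revSign_succ, ih, revSign_succ]
    ring

namespace VertexChain

/-- The signed reversal of the standard `n`-simplex. -/
def rev (n : ℕ) : VertexChain (Fin (n + 1)) n := revSign n • Finsupp.single Fin.rev 1

/-- The standard `n`-simplex. -/
def std (n : ℕ) : VertexChain (Fin (n + 1)) n := Finsupp.single id 1

theorem boundary_std (n : ℕ) : boundary n (std (n + 1)) = coface n n (std n) := by
  simp [std, boundary_single, coface_apply, map_single]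

theorem succAbove_comp_rev {n : ℕ} (i : Fin (n + 2)) :
    i.succAbove ∘ (Fin.rev : Fin (n + 1) → Fin (n + 1)) = Fin.rev ∘ i.rev.succAbove := by
  funext k
  simp [Fin.rev_succAbove]

theorem neg_one_pow_rev {n : ℕ} (i : Fin (n + 2)) :
    (-1 : ℤ) ^ (i.rev : ℕ) = (-1) ^ (n + 1) * (-1) ^ (i : ℕ) := by
  rw [← pow_add, Fin.val_rev, neg_one_pow_congr]
  have := i.is_lt
  grind

/-- Reversal exchanges the faces `i` and `n + 1 - i`, whose signs differ by `(-1)^(n+1)`; this is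
exactly the quotient of `revSign (n + 1)` and `revSign n`. So the signed reversal is a natural chain
map. -/
theorem boundary_rev (n : ℕ) : boundary n (rev (n + 1)) = coface n n (rev n) := by
  simp only [rev, map_zsmul, boundary_single, coface_apply, map_single, succAbove_comp_rev]
  rw [← Equiv.sum_comp Fin.revPerm, Finset.smul_sum, Finset.smul_sum]
  refine Finset.sum_congr rfl fun i _ => ?_
  simp only [Fin.revPerm_apply, smul_smul, neg_one_pow_rev, revSign_succ]
  congr 1
  have h : ((-1 : ℤ) ^ (n + 1)) * (-1) ^ (n + 1) = 1 := by
    rw [← mul_pow]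
    norm_num
  linear_combination (revSign n * (-1) ^ (i : ℕ)) * h

/-- A natural chain homotopy between the identity and the signed reversal. -/
def homotopy : (n : ℕ) → VertexChain (Fin (n + 1)) (n + 1)
  | 0 => 0
  -- Acyclic models: the chain in brackets is a cycle in the standard simplex, and the cone from
  -- vertex `0` fills it.
  | n + 1 => cone 0 (n + 1) (rev (n + 1) - std (n + 1) - coface n (n + 1) (homotopy n))

theorem boundary_homotopy_zero : boundary 0 (homotopy 0) = rev 0 - std 0 := by
  have : (Fin.rev : Fin 1 → Fin 1) = id := Subsingleton.elim _ _
  simp [homotopy, rev, std, revSign, this]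

/-- By `boundary_cone` the chain being coned must be a cycle. Its boundary is `coface` applied to
`rev n - std n` minus the boundary of `homotopy n`; by induction this difference is zero or itself a
coface, and `coface` squares to zero. -/
theorem boundary_homotopy_succ (n : ℕ) : boundary (n + 1) (homotopy (n + 1)) =
    rev (n + 1) - std (n + 1) - coface n (n + 1) (homotopy n) := by
  rw [homotopy, boundary_cone, sub_eq_self]
  refine (congrArg _ ?_).trans (map_zero (cone 0 n))
  rw [map_sub, map_sub, boundary_rev, boundary_std, boundary_coface, ← map_sub, ← map_sub]
  cases n with
  | zero => rw [boundary_homotopy_zero, sub_self, map_zero]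
  | succ n => rw [boundary_homotopy_succ n, sub_sub_cancel, coface_coface]

end VertexChain

end VertexChains

/-! ### Reversal of cochains and interchange of the factors of a cup product. -/

section Commutativity

variable {X : Type u} [TopologicalSpace X] {A : Type v} [AddCommGroup A]

/-- Evaluation of a cochain on chains of ordered simplices in the standard simplex, transported by
a singular simplex. -/
def vertexEval {n m : ℕ} (f : Cochain X A m) (s : SingularSimplex X n) :
    VertexChain (Fin (n + 1)) m →+ A :=
  Finsupp.liftAddHom fun g => zmultiplesHom A (f (reindex g s))

theorem vertexEval_single {n m : ℕ} (f : Cochain X A m) (s : SingularSimplex X n)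
    (g : Fin (m + 1) → Fin (n + 1)) : vertexEval f s (Finsupp.single g 1) = f (reindex g s) := by
  simp [vertexEval]

theorem vertexEval_boundary {n m : ℕ} (f : Cochain X A m) (s : SingularSimplex X n)
    (c : VertexChain (Fin (n + 1)) (m + 1)) :
    vertexEval f s (VertexChain.boundary m c) = vertexEval (coboundary m f) s c := by
  refine DFunLike.congr_fun (f := (vertexEval f s).comp (VertexChain.boundary m))
    (g := vertexEval (coboundary m f) s) (VertexChain.hom_ext fun g => ?_) c
  simp only [AddMonoidHom.comp_apply, VertexChain.boundary_single, map_sum, map_zsmul,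
    vertexEval_single, coboundary_apply, face, reindex_reindex]

theorem vertexEval_coface {n m : ℕ} (f : Cochain X A m) (s : SingularSimplex X (n + 1))
    (c : VertexChain (Fin (n + 1)) m) :
    vertexEval f s (VertexChain.coface n m c) =
      ∑ i : Fin (n + 2), (-1 : ℤ) ^ (i : ℕ) • vertexEval f (face i s) c := by
  simp only [VertexChain.coface_apply, map_sum, map_zsmul]
  refine Finset.sum_congr rfl fun i _ => ?_
  congr 1
  refine DFunLike.congr_fun (f := (vertexEval f s).comp (VertexChain.map i.succAbove m))
    (g := vertexEval f (face i s)) (VertexChain.hom_ext fun g => ?_) c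
  simp [VertexChain.map_single, vertexEval_single, face, reindex_reindex]

/-- The signed reversal of cochains. -/
def Cochain.rev {n : ℕ} (f : Cochain X A n) : Cochain X A n :=
  fun s => revSign n • f (reindex Fin.rev s)

theorem Cochain.rev_apply {n : ℕ} (f : Cochain X A n) (s : SingularSimplex X n) :
    f.rev s = revSign n • f (reindex Fin.rev s) := rfl

theorem vertexEval_rev {n : ℕ} (f : Cochain X A n) (s : SingularSimplex X n) :
    vertexEval f s (VertexChain.rev n) = f.rev s := by
  rw [VertexChain.rev, map_zsmul, vertexEval_single, Cochain.rev_apply]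

theorem vertexEval_std {n : ℕ} (f : Cochain X A n) (s : SingularSimplex X n) :
    vertexEval f s (VertexChain.std n) = f s := by
  rw [VertexChain.std, vertexEval_single]
  congr 1
  ext x
  simp [reindex]

/-- The signed reversal acts trivially on cohomology. -/
theorem rev_sub_mem_coboundaries {n : ℕ} {f : Cochain X A n} (hf : f ∈ cocycles X A n) :
    f.rev - f ∈ coboundaries X A n := by
  have hz : ∀ (s : SingularSimplex X n), vertexEval f s
      (VertexChain.boundary n (VertexChain.homotopy n)) = 0 := by
    intro s
    rw [vertexEval_boundary, mem_cocycles.mp hf]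
    refine DFunLike.congr_fun (f := vertexEval (0 : Cochain X A (n + 1)) s) (g := 0)
      (VertexChain.hom_ext fun g => ?_) _
    rw [vertexEval_single]
    rfl
  cases n with
  | zero =>
    have : f.rev - f = 0 := by
      funext s
      have := hz s
      rwa [VertexChain.boundary_homotopy_zero, map_sub, vertexEval_rev, vertexEval_std] at this
    rw [this]
    exact zero_mem _
  | succ n =>
    -- The primitive evaluates `f` on the homotopy one dimension lower; by naturality the coface
    -- term in `hz` is its coboundary.
    refine ⟨fun s => vertexEval f s (VertexChain.homotopy n), ?_⟩
    funext s
    have := hz s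
    rw [VertexChain.boundary_homotopy_succ, map_sub, map_sub, vertexEval_rev, vertexEval_std,
      vertexEval_coface, sub_eq_zero] at this
    exact this.symm

theorem rev_mem_cocycles {n : ℕ} {f : Cochain X A n} (hf : f ∈ cocycles X A n) :
    f.rev ∈ cocycles X A n := by
  have h : coboundaries X A n ≤ cocycles X A n := by
    cases n with
    | zero => exact bot_le
    | succ n =>
      rintro _ ⟨e, rfl⟩
      exact coboundary_coboundary n e
  simpa using add_mem (h (rev_sub_mem_coboundaries hf)) hf

variable {B : Type w} [AddCommGroup B] {C : Type*} [AddCommGroup C]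

/-- The cup product of cochains with respect to a pairing of the coefficients. -/
def cupWith (μ : A →+ B →+ C) {p q n : ℕ} (h : p + q = n) :
    Cochain X A p →+ Cochain X B q →+ Cochain X C n :=
  AddMonoidHom.mk'
    (fun a => AddMonoidHom.mk' (fun b s => μ (a (front (by omega) s)) (b (back h s)))
      (fun b b' => by funext s; simp))
    (fun a a' => by ext b s; simp)

theorem cupWith_apply (μ : A →+ B →+ C) {p q n : ℕ} (h : p + q = n) (a : Cochain X A p)
    (b : Cochain X B q) (s : SingularSimplex X n) :
    cupWith μ h a b s = μ (a (front (by omega) s)) (b (back h s)) := rfl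

/-- The faces `0, …, p` affect the front factor and the remaining ones the back factor. The right
side has two further terms, from the last face of the front simplex and the zeroth face of the back
one; they agree up to sign and cancel. -/
theorem coboundary_cupWith (μ : A →+ B →+ C) {p q n : ℕ} (h : p + q = n) (a : Cochain X A p)
    (b : Cochain X B q) :
    coboundary n (cupWith μ h a b) =
      cupWith μ (by omega) (coboundary p a) b +
        (-1 : ℤ) ^ p • cupWith μ (by omega) a (coboundary q b) := by
  subst h
  funext s
  simp only [coboundary_apply, cupWith_apply, Pi.add_apply, Pi.smul_apply]
  have e : (p + 1) + (q + 1) = p + q + 2 := by omega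
  rw [← (finCongr e).sum_comp, Fin.sum_univ_add]
  rw [Fin.sum_univ_castSucc (n := p + 1), Fin.sum_univ_succ (n := q + 1)]
  have h1 : ∀ i : Fin (p + 1),
      μ (a (front (Nat.le_add_right p q) (face (finCongr e (Fin.castAdd (q + 1) i)) s)))
        (b (back rfl (face (finCongr e (Fin.castAdd (q + 1) i)) s))) =
      μ (a (face i.castSucc (front (by omega : p + 1 ≤ p + q + 1) s)))
        (b (back (by omega : (p + 1) + q = p + q + 1) s)) := by
    intro i
    congr 2
    · simp only [face, front, reindex_reindex]
      congr 2
      funext k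
      ext
      simp [Function.comp, val_succAbove]
    · simp only [face, back, reindex_reindex]
      congr 1
      funext k
      ext
      simp [Function.comp, val_succAbove]
      split_ifs <;> omega
  have h2 : ∀ i : Fin (q + 1),
      μ (a (front (Nat.le_add_right p q) (face (finCongr e (Fin.natAdd (p + 1) i)) s)))
        (b (back rfl (face (finCongr e (Fin.natAdd (p + 1) i)) s))) =
      μ (a (front (by omega : p ≤ p + q + 1) s))
        (b (face i.succ (back (by omega : p + (q + 1) = p + q + 1) s))) := by
    intro i
    congr 2
    · simp only [face, front, reindex_reindex]
      congr 2
      funext k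
      ext
      simp [Function.comp, val_succAbove]
      omega
    · simp only [face, back, reindex_reindex]
      congr 1
      funext k
      ext
      simp [Function.comp, val_succAbove]
      all_goals (try split_ifs) <;> omega
  have h3 : face (Fin.last (p + 1)) (front (by omega : p + 1 ≤ p + q + 1) s) =
      front (by omega : p ≤ p + q + 1) s := by
    simp only [face, front, reindex_reindex]
    congr 1
    funext k
    ext
    simp [Function.comp]
  have h4 : face 0 (back (by omega : p + (q + 1) = p + q + 1) s) =
      back (by omega : (p + 1) + q = p + q + 1) s := by
    simp only [face, back, reindex_reindex]
    congr 1
    funext k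
    ext
    simp [Function.comp]
    omega
  simp only [h1, h2]
  simp only [map_add, map_sum, map_zsmul, AddMonoidHom.add_apply,
    AddMonoidHom.finsetSum_apply, AddMonoidHom.smul_apply, h3, h4, smul_add, Finset.smul_sum,
    smul_smul, finCongr_apply, Fin.val_cast, Fin.val_castAdd, Fin.val_natAdd, Fin.val_castSucc,
    Fin.val_last, Fin.val_succ, Fin.val_zero]
  have key : ∀ S1 S2 S2' y z : C, S2 = S2' → y + z = 0 → S1 + S2 = S1 + y + (z + S2') := by
    intro S1 S2 S2' y z hS hyz
    rw [hS, add_assoc, ← add_assoc y, hyz, zero_add]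
  refine key _ _ _ _ _ ?_ ?_
  · refine Finset.sum_congr rfl fun i _ => ?_
    congr 1
    ring
  · rw [← add_smul]
    convert zero_smul ℤ _
    ring

theorem cupWith_mem_coboundaries_left (μ : A →+ B →+ C) {p q n : ℕ} (h : p + q = n)
    {a : Cochain X A p} {b : Cochain X B q} (ha : a ∈ coboundaries X A p)
    (hb : b ∈ cocycles X B q) : cupWith μ h a b ∈ coboundaries X C n := by
  cases p with
  | zero =>
    obtain rfl : a = 0 := ha
    simp
  | succ p =>
    obtain ⟨e, rfl⟩ := ha
    obtain rfl : (p + q) + 1 = n := by omega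
    refine ⟨cupWith μ rfl e b, ?_⟩
    rw [coboundary_cupWith, mem_cocycles.mp hb]
    simp

theorem cupWith_mem_coboundaries_right (μ : A →+ B →+ C) {p q n : ℕ} (h : p + q = n)
    {a : Cochain X A p} {b : Cochain X B q} (ha : a ∈ cocycles X A p)
    (hb : b ∈ coboundaries X B q) : cupWith μ h a b ∈ coboundaries X C n := by
  cases q with
  | zero =>
    obtain rfl : b = 0 := hb
    simp
  | succ q =>
    obtain ⟨e, rfl⟩ := hb
    obtain rfl : (p + q) + 1 = n := by omega
    refine ⟨(-1 : ℤ) ^ p • cupWith μ rfl a e, ?_⟩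
    rw [map_zsmul, coboundary_cupWith, mem_cocycles.mp ha]
    simp [smul_smul, ← mul_pow]

theorem cupWith_mem_cocycles (μ : A →+ B →+ C) {p q n : ℕ} (h : p + q = n)
    {a : Cochain X A p} {b : Cochain X B q} (ha : a ∈ cocycles X A p)
    (hb : b ∈ cocycles X B q) : cupWith μ h a b ∈ cocycles X C n := by
  rw [mem_cocycles, coboundary_cupWith, mem_cocycles.mp ha, mem_cocycles.mp hb]
  simp

/-- Reversal interchanges the factors of a cup product. -/
theorem rev_cupWith (μ : A →+ B →+ C) {p q n : ℕ} (h : p + q = n) (h' : q + p = n)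
    (a : Cochain X A p) (b : Cochain X B q) :
    (cupWith μ h a b).rev = (-1 : ℤ) ^ (p * q) • cupWith μ.flip h' b.rev a.rev := by
  subst h
  funext s
  have h1 : front (Nat.le_add_right p q) (reindex Fin.rev s) = reindex Fin.rev (back h' s) := by
    simp only [front, back, reindex_reindex]
    congr 1
    funext k
    ext
    simp [Function.comp]
    omega
  have h2 : back rfl (reindex Fin.rev s) = reindex Fin.rev (front (by omega : q ≤ p + q) s) := by
    simp only [front, back, reindex_reindex]
    congr 1
    funext k
    ext
    simp [Function.comp]
    omega
  simp only [Cochain.rev_apply, cupWith_apply, Pi.smul_apply, h1, h2, AddMonoidHom.flip_apply,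
    map_zsmul, AddMonoidHom.smul_apply, smul_smul, revSign_add]

/-- Graded commutativity of the cup product. -/
theorem cupWith_sub_flip_mem_coboundaries (μ : A →+ B →+ C) {p q n : ℕ} (h : p + q = n)
    (h' : q + p = n) {a : Cochain X A p} {b : Cochain X B q} (ha : a ∈ cocycles X A p)
    (hb : b ∈ cocycles X B q) :
    cupWith μ h a b - (-1 : ℤ) ^ (p * q) • cupWith μ.flip h' b a ∈ coboundaries X C n := by
  -- Up to coboundaries `a ⌣ b` is its own reversal, which is `±` the product of the reversals of
  -- `b` and `a`; `h2` and `h3` then undo the reversal of one factor at a time.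
  have h1 := rev_sub_mem_coboundaries (cupWith_mem_cocycles μ h ha hb)
  have h2 := cupWith_mem_coboundaries_left μ.flip h' (rev_sub_mem_coboundaries hb)
    (rev_mem_cocycles ha)
  have h3 := cupWith_mem_coboundaries_right μ.flip h' hb (rev_sub_mem_coboundaries ha)
  rw [rev_cupWith μ h h'] at h1
  have h4 := sub_mem (zsmul_mem (add_mem h2 h3) ((-1 : ℤ) ^ (p * q))) h1
  convert h4 using 1
  simp only [map_sub, AddMonoidHom.sub_apply, smul_sub, smul_add]
  abel

end Commutativity

/-! ## Symmetry of the torsion pairing and the duality -/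

section Symmetry

variable {X : Type u} [TopologicalSpace X]

theorem cupWith_flip_smul {A : Type v} [AddCommGroup A] {p q n : ℕ} (h : p + q = n)
    (a : Cochain X A p) (b : Cochain X ℤ q) :
    cupWith (smulAddHom ℤ A).flip h a b = cochainCup h a b := rfl

theorem realToCircle_cupWith_left {p q n : ℕ} (h : p + q = n) (z : Cochain X ℤ p)
    (F : Cochain X ℝ q) :
    Cochain.realToCircle n (cupWith AddMonoidHom.mul h (Cochain.intToReal p z) F) =
      cupWith (smulAddHom ℤ UnitAddCircle) h z (Cochain.realToCircle q F) := by
  funext s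
  simp only [Cochain.mapCoeff, AddMonoidHom.coe_mk, ZeroHom.coe_mk, cupWith_apply,
    AddMonoidHom.mul_apply, smulAddHom_apply, ← map_zsmul, Int.coe_castAddHom, zsmul_eq_mul]

theorem realToCircle_cupWith_right {p q n : ℕ} (h : p + q = n) (F : Cochain X ℝ p)
    (z : Cochain X ℤ q) :
    Cochain.realToCircle n (cupWith AddMonoidHom.mul h F (Cochain.intToReal q z)) =
      cochainCup h (Cochain.realToCircle p F) z := by
  funext s
  simp only [Cochain.mapCoeff, AddMonoidHom.coe_mk, ZeroHom.coe_mk, cupWith_apply,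
    AddMonoidHom.mul_apply, cochainCup_apply, ← map_zsmul, Int.coe_castAddHom, zsmul_eq_mul,
    mul_comm]

/-- Symmetry of the linking form on the level of cochains. -/
theorem IsBockstein.cochainCup_sub_mem_coboundaries {p q : ℕ} {f : Cochain X UnitAddCircle p}
    {z : Cochain X ℤ (p + 1)} {f' : Cochain X UnitAddCircle q} {z' : Cochain X ℤ (q + 1)}
    (h : IsBockstein f z) (h' : IsBockstein f' z') (hf' : f' ∈ cocycles X UnitAddCircle q) :
    cochainCup (show p + (q + 1) = p + q + 1 by omega) f z' -
      (-1 : ℤ) ^ ((p + 1) * (q + 1)) • cochainCup (show q + (p + 1) = p + q + 1 by omega) f' z ∈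
        coboundaries X UnitAddCircle (p + q + 1) := by
  have h1 := cupWith_sub_flip_mem_coboundaries (smulAddHom ℤ UnitAddCircle)
    (show (p + 1) + q = p + q + 1 by omega) (by omega) h.mem_cocycles hf'
  rw [cupWith_flip_smul] at h1
  obtain ⟨F, rfl, hF⟩ := h
  obtain ⟨F', rfl, hF'⟩ := h'
  -- The Leibniz rule for the real lifts, read mod `ℤ`: `z ⌣ f' + (-1)^p f ⌣ z'` is exact, while
  -- `h1` replaces `z ⌣ f'` by `(-1)^{(p+1)q} f' ⌣ z`.
  have h2 : coboundary (p + q) (Cochain.realToCircle (p + q) (cupWith AddMonoidHom.mul rfl F F')) ∈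
      coboundaries X UnitAddCircle (p + q + 1) := ⟨_, rfl⟩
  rw [Cochain.coboundary_mapCoeff, coboundary_cupWith, hF, hF', map_add, map_zsmul,
    realToCircle_cupWith_left, realToCircle_cupWith_right] at h2
  convert zsmul_mem (sub_mem h2 h1) ((-1 : ℤ) ^ p) using 1
  have hp : (-1 : ℤ) ^ p * (-1) ^ p = 1 := by
    rw [← mul_pow]
    norm_num
  have hpq : (-1 : ℤ) ^ ((p + 1) * (q + 1)) = -((-1) ^ p * (-1) ^ ((p + 1) * q)) := by ring
  rw [add_sub_sub_cancel, smul_add, smul_smul, smul_smul, hp, one_smul, hpq, neg_smul,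
    sub_neg_eq_add]

/-- There are no nonzero coboundaries in degree zero, and integer-valued functions are torsion-free.
This makes the convention that `torsionPairing` vanishes for `p = 0` compatible with graded
symmetry. -/
theorem torsionCohomology_zero_eq_zero (t : TorsionCohomology X 0) : t = 0 := by
  obtain ⟨t, ht⟩ := t
  obtain ⟨z, rfl⟩ := cohomologyClass_surjective t
  obtain ⟨N, hN, h0⟩ := exists_nsmul_mem_coboundaries z ht
  obtain h0 : N • (z : Cochain X ℤ 0) = 0 := h0
  refine Subtype.ext ((cohomologyClass_eq_zero (f := z)).mpr ?_)
  rw [(smul_eq_zero.mp h0).resolve_left hN.ne']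
  exact zero_mem _

theorem exists_isBockstein_eq {p : ℕ} (t : TorsionCohomology X (p + 1)) :
    ∃ (f : cocycles X UnitAddCircle p) (z : cocycles X ℤ (p + 1)),
      IsBockstein (f : Cochain X UnitAddCircle p) (z : Cochain X ℤ (p + 1)) ∧
        cohomologyClass z = (t : Cohomology X ℤ (p + 1)) := by
  obtain ⟨u, hu⟩ := exists_bockstein_eq t
  obtain ⟨f, rfl⟩ := cohomologyClass_surjective u
  obtain ⟨z, hz⟩ := exists_isBockstein f
  exact ⟨f, ⟨z, hz.mem_cocycles⟩, hz, by rw [← hu, bockstein_class f ⟨z, hz.mem_cocycles⟩ hz]⟩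

theorem torsionPairing_succ {n : ℕ} (c : Homology X n) {p q : ℕ} (h : p + 1 + q = n + 1)
    (t : TorsionCohomology X (p + 1)) (t' : TorsionCohomology X q) :
    torsionPairing c (p + 1) q h t t' = cohomologyEval (linkingClass (by omega) t t') c := rfl

/-- Graded symmetry of the torsion pairing. -/
theorem torsionPairing_symm {n : ℕ} (c : Homology X n) (k l : ℕ) (h : k + l = n + 1)
    (h' : l + k = n + 1) (t : TorsionCohomology X k) (t' : TorsionCohomology X l) :
    torsionPairing c k l h t t' = (-1 : ℤ) ^ (k * l) • torsionPairing c l k h' t' t := by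
  cases k with
  | zero =>
    rw [torsionCohomology_zero_eq_zero t]
    simp
  | succ p =>
    cases l with
    | zero =>
      rw [torsionCohomology_zero_eq_zero t']
      simp
    | succ q =>
      obtain rfl : n = p + q + 1 := by omega
      obtain ⟨f, z, hb, hz⟩ := exists_isBockstein_eq t
      obtain ⟨f', z', hb', hz'⟩ := exists_isBockstein_eq t'
      rw [torsionPairing_succ, torsionPairing_succ,
        linkingClass_eq _ t t' (cohomologyClass f) ((bockstein_class f z hb).trans hz),
        linkingClass_eq _ t' t (cohomologyClass f') ((bockstein_class f' z' hb').trans hz'),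
        ← hz, ← hz', cup_class, cup_class, cocycleCup_apply, cocycleCup_apply,
        ← AddMonoidHom.smul_apply, ← map_zsmul, ← map_zsmul]
      refine DFunLike.congr_fun (congrArg _ ?_) c
      rw [← sub_eq_zero, ← map_sub, cohomologyClass_eq_zero]
      exact hb.cochainCup_sub_mem_coboundaries hb' f'.2

/-- The duality `ζ_tor` preserves the forms. -/
theorem sigmaTorSurface_zetaTor {n : ℕ} (c : Homology X n) (k l : ℕ) (h : k + l = n + 1)
    (h' : l + k = n + 1) (x y : TopTor X k l) :
    (sigmaTorSurface c l k h').toHom (zetaTor X k l x) (zetaTor X k l y) =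
      (sigmaTorSurface c k l h).toHom x y := by
  -- The sign `(-1)^{kl+1}` of `ζ_tor` times the symmetry sign `(-1)^{kl}` is `-1`, so `ζ_tor`
  -- merely swaps the two terms of the form.
  have key : ∀ (t : TorsionCohomology X k) (t' : TorsionCohomology X l),
      torsionPairing c k l h ((-1 : ℤ) ^ (k * l + 1) • t) t' = -torsionPairing c l k h' t' t := by
    intro t t'
    rw [map_zsmul, AddMonoidHom.smul_apply, torsionPairing_symm c k l h h', smul_smul, pow_succ,
      mul_assoc, mul_comm (-1 : ℤ), ← mul_assoc, ← mul_pow]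
    norm_num
  rw [sigmaTorSurface_apply, sigmaTorSurface_apply]
  change torsionPairing c k l _ ((-1 : ℤ) ^ (k * l + 1) • x.1) y.2 -
    torsionPairing c k l _ ((-1 : ℤ) ^ (k * l + 1) • y.1) x.2 = _
  rw [key, key]
  abel

theorem pullback_zetaTor {Y : Type v} [TopologicalSpace Y] (i : C(X, Y)) (k l : ℕ)
    (x : TopTor Y k l) :
    TopTor.pullback i l k (zetaTor Y k l x) = zetaTor X k l (TopTor.pullback i k l x) :=
  Prod.ext rfl (map_zsmul (TorsionCohomology.pullback i k) _ _)

theorem zetaTor_eq_zero_iff {k l : ℕ} {x : TopTor X k l} : zetaTor X k l x = 0 ↔ x = 0 := by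
  refine ⟨fun h => ?_, fun h => by rw [h, map_zero]⟩
  have h1 : x.2 = 0 := congrArg Prod.fst h
  have h2 : (-1 : ℤ) ^ (k * l + 1) • x.1 = 0 := congrArg Prod.snd h
  have h3 : ((-1 : ℤ) ^ (k * l + 1) * (-1) ^ (k * l + 1)) • x.1 = 0 := by
    rw [mul_smul, h2, smul_zero]
  rw [← mul_pow] at h3
  exact Prod.ext (by simpa using h3) h1

theorem isAddTorsion_topTor (k l : ℕ) : IsAddTorsion (TopTor X k l) := by
  have h : ∀ {n : ℕ} (t : TorsionCohomology X n), IsOfFinAddOrder t := fun t =>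
    AddSubmonoid.isOfFinAddOrder_coe.mp t.2
  exact fun x => (h x.1).prod_mk (h x.2)

end Symmetry

/-! ### The torsion sector of a spacetime. -/

namespace CauchySpacetime

open scoped Manifold ContDiff

variable {n : ℕ} {M : Type u} [TopologicalSpace M]
  [ChartedSpace (EuclideanSpace ℝ (Fin (n + 1))) M] [IsManifold (𝓡 (n + 1)) ∞ M]
  {S : Type v} [TopologicalSpace S]
  [ChartedSpace (EuclideanSpace ℝ (Fin n)) S]
  (D : CauchySpacetime n M S) {k l : ℕ} (h : k + l = n + 1) (h' : l + k = n + 1)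

/-- On the diagonal the two terms of the form coincide. This supplies the hypothesis `hσ` of the
regular representation. -/
theorem sigmaTor_self (x : TopTor M k l) : (D.sigmaTor k l h).toHom x x = 0 := by
  change (sigmaTorSurface D.fundamentalClass k l h).toHom (TopTor.pullback D.incl k l x)
    (TopTor.pullback D.incl k l x) = 0
  rw [sigmaTorSurface_apply, sub_self]

theorem sigmaTor_zetaTor (x y : TopTor M k l) :
    (D.sigmaTor l k h').toHom (zetaTor M k l x) (zetaTor M k l y) =
      (D.sigmaTor k l h).toHom x y := by
  change (sigmaTorSurface D.fundamentalClass l k h').toHom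
    (TopTor.pullback D.incl l k (zetaTor M k l x)) (TopTor.pullback D.incl l k (zetaTor M k l y)) =
      (sigmaTorSurface D.fundamentalClass k l h).toHom (TopTor.pullback D.incl k l x)
        (TopTor.pullback D.incl k l y)
  rw [pullback_zetaTor, pullback_zetaTor, sigmaTorSurface_zetaTor _ k l h h']

theorem isTorFunctional_iff [IsManifold (𝓡 n) ∞ S] {φ : D.TorWeylAlgebra k l h →L[ℂ] ℂ} :
    D.IsTorFunctional φ ↔ φ = weylTrace (D.sigmaTor_self h) := by
  refine ⟨fun hφ => eq_weylTrace _ hφ.1 hφ.2, ?_⟩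
  rintro rfl
  exact ⟨by rw [weylTrace_weyl, if_pos rfl], fun x hx => by rw [weylTrace_weyl, if_neg hx]⟩

end CauchySpacetime

end AbelianDuality

end

open scoped Manifold ContDiff in
theorem mainTheorem8 (n : ℕ)
    (M : Type*) [TopologicalSpace M] [T2Space M] [SecondCountableTopology M] [ConnectedSpace M]
    [ChartedSpace (EuclideanSpace ℝ (Fin (n + 1))) M] [IsManifold (𝓡 (n + 1)) ∞ M]
    (S : Type*) [TopologicalSpace S] [CompactSpace S]
    [ChartedSpace (EuclideanSpace ℝ (Fin n)) S] [IsManifold (𝓡 n) ∞ S]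
    (D : AbelianDuality.CauchySpacetime n M S)
    (k l : ℕ) (h : k + l = n + 1) (h' : l + k = n + 1) :
    (∃! φ : D.TorWeylAlgebra k l h →L[ℂ] ℂ, D.IsTorFunctional φ) ∧
    (∃! Z : D.TorWeylAlgebra k l h →⋆ₐ[ℂ] D.TorWeylAlgebra l k h', D.IsTorDuality Z) ∧
    (∀ φ : D.TorWeylAlgebra k l h →L[ℂ] ℂ, D.IsTorFunctional φ →
      AbelianDuality.IsState φ ∧ AbelianDuality.IsFaithful φ) ∧
    (∀ (φ : D.TorWeylAlgebra k l h →L[ℂ] ℂ) (ψ : D.TorWeylAlgebra l k h' →L[ℂ] ℂ)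
      (Z : D.TorWeylAlgebra k l h →⋆ₐ[ℂ] D.TorWeylAlgebra l k h'),
      D.IsTorFunctional φ → D.IsTorFunctional ψ → D.IsTorDuality Z →
        ∀ a, ψ (Z a) = φ a) := by
  refine ⟨⟨AbelianDuality.weylTrace (D.sigmaTor_self h), (D.isTorFunctional_iff h).mpr rfl,
      fun φ hφ => (D.isTorFunctional_iff h).mp hφ⟩,
    AbelianDuality.existsUnique_weylMap (AbelianDuality.zetaTor M k l)
      (D.sigmaTor_zetaTor h h'), fun φ hφ => ?_, fun φ ψ Z hφ hψ hZ a => ?_⟩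
  · rw [(D.isTorFunctional_iff h).mp hφ]
    exact ⟨AbelianDuality.isState_weylTrace _,
      AbelianDuality.isFaithful_weylTrace _ (AbelianDuality.isAddTorsion_topTor k l)⟩
  -- Since `ζ_tor` vanishes only at `0`, `ψ ∘ Z` has the values on generators that characterize `φ`;
  -- uniqueness identifies the two.
  · have key : D.IsTorFunctional
        (ψ.comp ⟨Z.toLinearMap, AbelianDuality.continuous_starHom Z⟩) := by
      refine ⟨?_, fun x hx => ?_⟩
      · change ψ (Z _) = 1
        rw [hZ, map_zero, hψ.1]
      · change ψ (Z _) = 0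
        rw [hZ, hψ.2 _ (mt AbelianDuality.zetaTor_eq_zero_iff.mp hx)]
    exact DFunLike.congr_fun (((D.isTorFunctional_iff h).mp key).trans
      ((D.isTorFunctional_iff h).mp hφ).symm) a
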